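/- **Definitions.** Let $\varphi:\mathbb R^2\to\mathbb R^2$ be continuous. A point $p$ is an *unfolded point* if $\varphi$ preserves distances on a neighborhood of $p$. It is a *crease point* if it is not unfolded and some neighborhood of $p$ is covered by two sets containing $p$, on which $\varphi$ agrees with two different isometries of the plane. It is a *vertex point* if it is neither unfolded nor a crease point and some neighborhood of $p$ is covered by finitely many sets containing $p$, on each of which $\varphi$ agrees with an isometry of the plane, at least three of these isometries being different. The map $\varphi$ is a *local flat folding* if every point of the plane is of one of these three types and there is at least one vertex point. The *graph* of a local flat folding $\varphi$ is the plane multigraph whose vertices are the vertex points and, if there is a ray of crease points, one further vertex $\infty$. It has an edge between two vertex points $p,q$ when the open segment between them consists of crease points, and an edge between $p$ and $\infty$ for each ray with apex $p$ that consists, apart from $p$, of crease points. The edges at each vertex carry the cyclic order in which they appear around it ($\infty$ being the point at infinity of the sphere). *Wheel replacement* at a vertex $v$ of degree $d$ of a plane multigraph replaces $v$ by a wheel, consisting of a cycle of $d$ vertices and a hub adjacent to all of them. Each edge formerly at $v$ is attached to its own cycle vertex, in the same cyclic order. The *dual orthotrees* are the plane multigraphs obtained by repeated wheel replacement (at arbitrary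 vertices) from the plane multigraph with two vertices and four edges joining them. **Theorem.** Every dual orthotree is isomorphic, as a plane multigraph, to the graph of a local flat folding. Moreover, let $G_0,G_1,\dots,G_k$ be plane multigraphs such that $G_0$ is the two-vertex four-edge multigraph and $G_{i+1}$ is obtained from $G_i$ by wheel replacement at a vertex $v_i$, and let $w$ be a vertex of $G_0$. Then there are local flat foldings $\varphi_0,\dots,\varphi_k$ and isomorphisms $e_i$ of plane multigraphs from $G_i$ to the graph of $\varphi_i$, with $e_0(w)=\infty$, such that the image of each $\varphi_i$ lies in a wedge of opening angle less than $\pi$, and for each $i<k$ the map $\varphi_{i+1}$ arises from $\varphi_i$ by folding over the corner at $e_i(v_i)$. That is, there are a line $\ell$, an open side $H$ of $\ell$ and a neighborhood $U$ of $e_i(v_i)$ (for $e_i(v_i)=\infty$: a set with relatively compact complement) containing no vertex point of $\varphi_i$ other than possibly $e_i(v_i)$, such that $\varphi_i$ maps all points sufficiently close to $e_i(v_i)$ into $H$, and $\varphi_{i+1}(x)$ is the reflection of $\varphi_i(x)$ across $\ell$ if $x\in U$ and $\varphi_i(x)\in H$, and $\varphi_{i+1}(x)=\varphi_i(x)$ otherwise.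 -/

import Mathlib

open Set Filter Topology

/-! ## Local flat foldings of the plane

The Euclidean plane is `ℂ` with its usual metric; multiplication by `Complex.I` is the
counterclockwise quarter turn. -/

/-- `φ` preserves distances on a neighbourhood of `p`. -/
def IsUnfoldedPoint (φ : ℂ → ℂ) (p : ℂ) : Prop :=
  ∃ N ∈ 𝓝 p, ∀ x ∈ N, ∀ y ∈ N, dist (φ x) (φ y) = dist x y

/-- Some neighbourhood of `p` is covered by the sets `A i`, each of which contains `p` and on
each of which `φ` acts as the isometry `f i` of the plane. -/
def IsLocalCover (φ : ℂ → ℂ) (p : ℂ) {k : ℕ} (A : Fin k → Set ℂ) (f : Fin k → (ℂ ≃ᵢ ℂ)) : Prop :=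
  (⋃ i, A i) ∈ 𝓝 p ∧ ∀ i, p ∈ A i ∧ EqOn φ (f i) (A i)

/-- A neighbourhood of `p` is covered by two sets on which `φ` acts by two different isometries.
The point is required not to be unfolded, because a set such as `{p}` could otherwise serve as
the second set at an unfolded point. -/
def IsCreasePoint (φ : ℂ → ℂ) (p : ℂ) : Prop :=
  ¬ IsUnfoldedPoint φ p ∧
    ∃ (A : Fin 2 → Set ℂ) (f : Fin 2 → (ℂ ≃ᵢ ℂ)), f 0 ≠ f 1 ∧ IsLocalCover φ p A f

/-- A neighbourhood of `p` is covered by finitely many sets on each of which `φ` acts by an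
isometry, with at least three different isometries, and fewer isometries do not suffice. -/
def IsVertexPoint (φ : ℂ → ℂ) (p : ℂ) : Prop :=
  ¬ IsUnfoldedPoint φ p ∧ ¬ IsCreasePoint φ p ∧
    ∃ (k : ℕ) (A : Fin k → Set ℂ) (f : Fin k → (ℂ ≃ᵢ ℂ)),
      3 ≤ (range f).ncard ∧ IsLocalCover φ p A f

/-- A local flat folding: a continuous map of the plane to itself, all of whose points are
unfolded points, crease points or vertex points, with at least one vertex point. -/
def IsLocalFlatFolding (φ : ℂ → ℂ) : Prop :=
  Continuous φ ∧ (∀ p, IsUnfoldedPoint φ p ∨ IsCreasePoint φ p ∨ IsVertexPoint φ p) ∧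
    ∃ p, IsVertexPoint φ p

/-! ## The plane graph of a local flat folding -/

/-- The open ray from `p` in the unit direction `u` consists of crease points. -/
def IsCreaseRay (φ : ℂ → ℂ) (p u : ℂ) : Prop :=
  ‖u‖ = 1 ∧ ∀ t : ℝ, 0 < t → IsCreasePoint φ (p + t * u)

/-- The vertices: the vertex points and, if there is a ray of crease points, the vertex `∞`. -/
inductive FoldVertex (φ : ℂ → ℂ) : Type
  | point (p : ℂ) (hp : IsVertexPoint φ p) : FoldVertex φ
  | infinity (h : ∃ p u, IsCreaseRay φ p u) : FoldVertex φ

/-- The darts (edges with a direction of travel): `segment p q` runs from the vertex point `p` to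
the vertex point `q`, `ray p u` runs from the vertex point `p` to `∞` in the unit direction `u`,
and `rayRev p u` is the same edge, travelled from `∞` to `p`. -/
inductive FoldDart (φ : ℂ → ℂ) : Type
  | segment (p q : ℂ) (hp : IsVertexPoint φ p) (hq : IsVertexPoint φ q)
      (h : ∀ x ∈ openSegment ℝ p q, IsCreasePoint φ x) : FoldDart φ
  | ray (p u : ℂ) (hp : IsVertexPoint φ p) (h : IsCreaseRay φ p u) : FoldDart φ
  | rayRev (p u : ℂ) (hp : IsVertexPoint φ p) (h : IsCreaseRay φ p u) : FoldDart φ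

/-- The vertex at which a dart starts. -/
def FoldDart.tail {φ : ℂ → ℂ} : FoldDart φ → FoldVertex φ
  | .segment p _ hp _ _ => .point p hp
  | .ray p _ hp _ => .point p hp
  | .rayRev p u _ h => .infinity ⟨p, u, h⟩

/-- The same edge, travelled in the other direction. -/
def FoldDart.rev {φ : ℂ → ℂ} : FoldDart φ → FoldDart φ
  | .segment p q hp hq h => .segment q p hq hp (fun x hx => h x (openSegment_symm ℝ q p ▸ hx))
  | .ray p u hp h => .rayRev p u hp h
  | .rayRev p u hp h => .ray p u hp h

/-- A coordinate in which the darts at a vertex appear in counterclockwise order. At a vertex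
point it is the angle of the dart. The rays meet a very large circle in counterclockwise order of
their angles, and parallel rays in the order of their signed offsets; on the sphere, where the
orientation around `∞` is seen from the other side, this order has to be reversed. -/
noncomputable def FoldDart.slot {φ : ℂ → ℂ} : FoldDart φ → ℝ ×ₗ ℝ
  | .segment p q _ _ _ => toLex (Complex.arg (q - p), 0)
  | .ray _ u _ _ => toLex (Complex.arg u, 0)
  | .rayRev p u _ _ => toLex (-Complex.arg u, -((starRingEnd ℂ) u * p).im)

/-- `b` is the cyclic successor of `a` in the subset `S` of a linear order: the next larger
element, or the least element if `a` is the greatest. -/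
def IsCyclicSucc {α : Type*} [LinearOrder α] (S : Set α) (a b : α) : Prop :=
  a ∈ S ∧ b ∈ S ∧
    ((a < b ∧ ∀ x ∈ S, ¬ (a < x ∧ x < b)) ∨ (IsGreatest S a ∧ IsLeast S b))

/-- The dart `e` follows the dart `d` in the counterclockwise order around their vertex. -/
def FoldDart.IsNext {φ : ℂ → ℂ} (d e : FoldDart φ) : Prop :=
  e.tail = d.tail ∧ IsCyclicSucc (FoldDart.slot '' {x | x.tail = d.tail}) d.slot e.slot

/-! ## Plane multigraphs as rotation systems -/

/-- A finite multigraph with a rotation system. Every edge is a pair of opposite darts `d`,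
`rev d`, the dart `d` starts at the vertex `tail d`, and `rot d` is the next dart in
counterclockwise order around that vertex. -/
structure RotationSystem where
  V : Type
  D : Type
  finite_V : Finite V
  finite_D : Finite D
  tail : D → V
  rev : D → D
  rev_rev : ∀ d, rev (rev d) = d
  rev_ne : ∀ d, rev d ≠ d
  rot : Equiv.Perm D
  tail_rot : ∀ d, tail (rot d) = tail d
  sameCycle : ∀ d e, tail d = tail e → rot.SameCycle d e

/-- Isomorphisms of plane multigraphs. -/
structure RotationSystem.Iso (G H : RotationSystem) where
  onV : G.V ≃ H.V
  onD : G.D ≃ H.D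
  tail_onD : ∀ d, H.tail (onD d) = onV (G.tail d)
  rev_onD : ∀ d, H.rev (onD d) = onD (G.rev d)
  rot_onD : ∀ d, H.rot (onD d) = onD (G.rot d)

/-- An isomorphism from the plane multigraph `G` to the plane graph of the folding `φ`. -/
structure FoldRealization (G : RotationSystem) (φ : ℂ → ℂ) where
  onV : G.V ≃ FoldVertex φ
  onD : G.D ≃ FoldDart φ
  tail_onD : ∀ d, (onD d).tail = onV (G.tail d)
  rev_onD : ∀ d, (onD d).rev = onD (G.rev d)
  next_onD : ∀ d, (onD d).IsNext (onD (G.rot d))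

/-! ## Wheel replacement and dual orthotrees -/

/-- The plane multigraph with two vertices and four edges between them. The edges appear in
opposite cyclic orders around the two vertices. -/
def dipole : RotationSystem where
  V := Bool
  D := Bool × ZMod 4
  finite_V := inferInstance
  finite_D := inferInstanceAs (Finite (Bool × Fin 4))
  tail := Prod.fst
  rev d := (!d.1, d.2)
  rev_rev := by rintro ⟨b, i⟩; simp
  rev_ne := by rintro ⟨b, i⟩ h; simpa using congrArg Prod.fst h
  rot :=
    { toFun := fun d => (d.1, if d.1 then d.2 + 1 else d.2 - 1)
      invFun := fun d => (d.1, if d.1 then d.2 - 1 else d.2 + 1)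
      left_inv := by rintro ⟨b, i⟩; cases b <;> simp
      right_inv := by rintro ⟨b, i⟩; cases b <;> simp }
  tail_rot := fun _ => rfl
  sameCycle := by
    rintro ⟨b, i⟩ ⟨c, j⟩ h
    obtain rfl : b = c := h
    have key : ∀ (b : Bool) (i j : ZMod 4), ∃ n : Fin 4,
        ((fun d : Bool × ZMod 4 => (d.1, if d.1 then d.2 + 1 else d.2 - 1))^[n]) (b, i)
          = (b, j) := by decide
    obtain ⟨n, hn⟩ := key b i j
    refine ⟨((n : ℕ) : ℤ), ?_⟩
    rw [zpow_natCast, Equiv.Perm.coe_pow]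
    exact hn

namespace RotationSystem

/-- The darts that start at `v`. -/
abbrev DartsAt (G : RotationSystem) (v : G.V) : Type := {d : G.D // G.tail d = v}

/-- The counterclockwise rotation of the darts at `v`. -/
def rotAt (G : RotationSystem) (v : G.V) : Equiv.Perm (G.DartsAt v) :=
  G.rot.subtypePerm (fun d => by rw [G.tail_rot])

/-- The darts after the replacement of `v` by a wheel. The wheel has one cycle vertex for each
dart `x` at `v`. Its darts are `fwd x`, along the cycle from the cycle vertex of `x` to that of
the next dart, `bwd x`, the opposite of `fwd x`, `spoke x`, from the cycle vertex of `x` to the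
hub, and `hub x`, the opposite of `spoke x`. -/
inductive WheelDart (G : RotationSystem) (v : G.V) : Type
  | old (d : G.D) : WheelDart G v
  | fwd (x : G.DartsAt v) : WheelDart G v
  | bwd (x : G.DartsAt v) : WheelDart G v
  | spoke (x : G.DartsAt v) : WheelDart G v
  | hub (x : G.DartsAt v) : WheelDart G v

namespace WheelDart

variable {G : RotationSystem} {v : G.V}

/-- The vertices of the new graph are those of `G`, with `v` in the role of the hub, and the cycle
vertices. An old dart at `v` now starts at its cycle vertex. -/
noncomputable def tail : WheelDart G v → G.V ⊕ G.DartsAt v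
  | old d => by
      classical exact if h : G.tail d = v then Sum.inr ⟨d, h⟩ else Sum.inl (G.tail d)
  | fwd x => Sum.inr x
  | bwd x => Sum.inr (G.rotAt v x)
  | spoke x => Sum.inr x
  | hub _ => Sum.inl v

def rev : WheelDart G v → WheelDart G v
  | old d => old (G.rev d)
  | fwd x => bwd x
  | bwd x => fwd x
  | spoke x => hub x
  | hub x => spoke x

/-- Counterclockwise around the cycle vertex of `x`: the old dart `x`, the dart along the cycle to
the next cycle vertex, the spoke, the dart along the cycle to the previous cycle vertex. -/
noncomputable def rotFun : WheelDart G v → WheelDart G v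
  | old d => by
      classical exact if h : G.tail d = v then fwd ⟨d, h⟩ else old (G.rot d)
  | fwd x => spoke x
  | spoke x => bwd ((G.rotAt v).symm x)
  | bwd x => old (G.rotAt v x).1
  | hub x => hub (G.rotAt v x)

noncomputable def rotInv : WheelDart G v → WheelDart G v
  | old d => by
      classical
      exact if h : G.tail d = v then bwd ((G.rotAt v).symm ⟨d, h⟩) else old (G.rot.symm d)
  | fwd x => old x.1
  | spoke x => fwd x
  | bwd x => spoke (G.rotAt v x)
  | hub x => hub ((G.rotAt v).symm x)

theorem tail_rot_symm (d : G.D) : G.tail (G.rot.symm d) = G.tail d := by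
  have h := G.tail_rot (G.rot.symm d)
  rw [Equiv.apply_symm_apply] at h
  exact h.symm

noncomputable def rot : Equiv.Perm (WheelDart G v) where
  toFun := rotFun
  invFun := rotInv
  left_inv := by
    intro d
    cases d with
    | old d =>
      by_cases h : G.tail d = v
      · simp [rotFun, rotInv, h]
      · simp [rotFun, rotInv, h, G.tail_rot]
    | fwd x => rfl
    | bwd x => simp [rotFun, rotInv, (G.rotAt v x).2]
    | spoke x => simp [rotFun, rotInv]
    | hub x => simp [rotFun, rotInv]
  right_inv := by
    intro d
    cases d with
    | old d =>
      by_cases h : G.tail d = v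
      · simp [rotFun, rotInv, h]
      · simp [rotFun, rotInv, h, tail_rot_symm]
    | fwd x => simp [rotFun, rotInv, x.2]
    | bwd x => simp [rotFun, rotInv]
    | spoke x => rfl
    | hub x => simp [rotFun, rotInv]

theorem rot_apply (d : WheelDart G v) : rot d = rotFun d := rfl

theorem finite : Finite (WheelDart G v) := by
  have := G.finite_D
  let f : WheelDart G v → G.D × Fin 5 := fun
    | old d => (d, 0)
    | fwd x => (x.1, 1)
    | bwd x => (x.1, 2)
    | spoke x => (x.1, 3)
    | hub x => (x.1, 4)
  refine Finite.of_injective f ?_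
  intro a b h
  cases a <;> cases b <;> simp_all [f, Subtype.ext_iff]

theorem tail_rot (d : WheelDart G v) : (rot d).tail = d.tail := by
  change (rotFun d).tail = d.tail
  cases d with
  | old d =>
    by_cases h : G.tail d = v
    · simp [rotFun, tail, h]
    · simp [rotFun, tail, h, G.tail_rot]
  | fwd x => rfl
  | bwd x => simp [rotFun, tail, (G.rotAt v x).2]
  | spoke x => simp [rotFun, tail]
  | hub x => rfl

theorem sameCycle_spoke (d : WheelDart G v) (x : G.DartsAt v) (h : d.tail = Sum.inr x) :
    (rot : Equiv.Perm (WheelDart G v)).SameCycle d (spoke x) := by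
  have hf : ∀ y : G.DartsAt v, (rot : Equiv.Perm (WheelDart G v)).SameCycle (fwd y) (spoke y) :=
    fun y => Equiv.Perm.sameCycle_apply_right.2 (Equiv.Perm.SameCycle.refl rot (fwd y))
  cases d with
  | old d =>
    by_cases hd : G.tail d = v
    · have hx : (⟨d, hd⟩ : G.DartsAt v) = x := by simpa [tail, hd] using h
      have hr : rot (old d : WheelDart G v) = fwd x := by
        simp [rot_apply, rotFun, hd, hx]
      rw [← Equiv.Perm.sameCycle_apply_left, hr]
      exact hf x
    · simp [tail, hd] at h
  | fwd y =>
    obtain rfl : y = x := by simpa [tail] using h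
    exact hf y
  | bwd y =>
    have hx : G.rotAt v y = x := by simpa [tail] using h
    have hr : rot (spoke x : WheelDart G v) = bwd y := by
      simp [rot_apply, rotFun, ← hx]
    rw [← hr]
    exact Equiv.Perm.sameCycle_apply_left.2 (Equiv.Perm.SameCycle.refl _ _)
  | spoke y =>
    obtain rfl : y = x := by simpa [tail] using h
    exact Equiv.Perm.SameCycle.refl _ _
  | hub y => simp [tail] at h

theorem rotAt_pow_val (x : G.DartsAt v) (n : ℕ) : ((G.rotAt v ^ n) x).1 = (G.rot ^ n) x.1 := by
  induction n with
  | zero => rfl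
  | succ n ih => rw [pow_succ', pow_succ', Equiv.Perm.mul_apply, Equiv.Perm.mul_apply, ← ih]; rfl

theorem rot_pow_hub (x : G.DartsAt v) (n : ℕ) :
    (rot ^ n) (hub x : WheelDart G v) = hub ((G.rotAt v ^ n) x) := by
  induction n with
  | zero => rfl
  | succ n ih => rw [pow_succ', pow_succ', Equiv.Perm.mul_apply, Equiv.Perm.mul_apply, ih]; rfl

theorem rot_pow_old (d : G.D) (hd : G.tail d ≠ v) (n : ℕ) :
    (rot ^ n) (old d : WheelDart G v) = old ((G.rot ^ n) d) ∧ G.tail ((G.rot ^ n) d) ≠ v := by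
  induction n with
  | zero => exact ⟨rfl, hd⟩
  | succ n ih =>
    rw [pow_succ', pow_succ', Equiv.Perm.mul_apply, Equiv.Perm.mul_apply, ih.1, G.tail_rot]
    refine ⟨?_, ih.2⟩
    simp [rot_apply, rotFun, ih.2]

theorem sameCycle (d e : WheelDart G v) (h : d.tail = e.tail) :
    (rot : Equiv.Perm (WheelDart G v)).SameCycle d e := by
  have := G.finite_D
  rcases hd : d.tail with w | x
  · have hcase : ∀ a : WheelDart G v, a.tail = Sum.inl w →
        (∃ b, a = old b ∧ G.tail b ≠ v ∧ G.tail b = w) ∨ (∃ y, a = hub y ∧ w = v) := by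
      intro a ha
      cases a with
      | old b =>
        by_cases hb : G.tail b = v
        · simp [tail, hb] at ha
        · exact Or.inl ⟨b, rfl, hb, by simpa [tail, hb] using ha⟩
      | hub y => exact Or.inr ⟨y, rfl, by simpa [tail, eq_comm] using ha⟩
      | fwd y => simp [tail] at ha
      | bwd y => simp [tail] at ha
      | spoke y => simp [tail] at ha
    rcases hcase d hd with ⟨b, rfl, hb, hbw⟩ | ⟨y, rfl, hw⟩ <;>
      rcases hcase e (h ▸ hd) with ⟨b', rfl, hb', hbw'⟩ | ⟨y', rfl, hw'⟩
    · obtain ⟨n, hn⟩ := (G.sameCycle b b' (hbw.trans hbw'.symm)).exists_nat_pow_eq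
      exact ⟨n, by rw [zpow_natCast, (rot_pow_old b hb n).1, hn]⟩
    · exact absurd (hbw.trans hw') hb
    · exact absurd (hbw'.trans hw) hb'
    · obtain ⟨n, hn⟩ := (G.sameCycle y.1 y'.1 (y.2.trans y'.2.symm)).exists_nat_pow_eq
      refine ⟨n, ?_⟩
      rw [zpow_natCast, rot_pow_hub]
      exact congrArg hub (Subtype.ext ((rotAt_pow_val y n).trans hn))
  · exact (sameCycle_spoke d x hd).trans (sameCycle_spoke e x (h ▸ hd)).symm

end WheelDart

/-- The replacement of the vertex `v` by a wheel. -/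
noncomputable def wheelReplace (G : RotationSystem) (v : G.V) : RotationSystem where
  V := G.V ⊕ G.DartsAt v
  D := WheelDart G v
  finite_V := by
    have := G.finite_V
    have := G.finite_D
    infer_instance
  finite_D := WheelDart.finite
  tail := WheelDart.tail
  rev := WheelDart.rev
  rev_rev := by
    intro d
    cases d <;> simp [WheelDart.rev, G.rev_rev]
  rev_ne := by
    intro d
    cases d <;> simp [WheelDart.rev, G.rev_ne]
  rot := WheelDart.rot
  tail_rot := WheelDart.tail_rot
  sameCycle := WheelDart.sameCycle

end RotationSystem

/-- The dual orthotrees: the plane multigraphs that are obtained, up to isomorphism, from the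
two-vertex four-edge multigraph by repeated wheel replacement. -/
inductive IsDualOrthotree : RotationSystem → Prop
  | start (G : RotationSystem) (h : Nonempty (dipole.Iso G)) : IsDualOrthotree G
  | wheel (G H : RotationSystem) (v : G.V) (hG : IsDualOrthotree G)
      (h : Nonempty ((G.wheelReplace v).Iso H)) : IsDualOrthotree H

/-! ## Folding over a corner -/

/-- The image of `φ` lies in a wedge of opening angle less than `π`, with apex `a` and sides in
the directions `u` and `w`. -/
def ImageInWedge (φ : ℂ → ℂ) : Prop :=
  ∃ a u w : ℂ, LinearIndependent ℝ ![u, w] ∧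
    ∀ x, ∃ s t : ℝ, 0 ≤ s ∧ 0 ≤ t ∧ φ x = a + s * u + t * w

/-- For a unit vector `n`, the reflection of the plane across the line `⟪n, z⟫ = c`. -/
noncomputable def reflectAcross (n : ℂ) (c : ℝ) (z : ℂ) : ℂ :=
  z - (2 * (inner ℝ n z - c) : ℝ) * n

/-- The neighbourhoods of a vertex in the plane; those of `∞` are the sets with relatively compact
complement. -/
noncomputable def FoldVertex.nhds {φ : ℂ → ℂ} : FoldVertex φ → Filter ℂ
  | .point p _ => 𝓝 p
  | .infinity _ => cocompact ℂ

/-- `ψ` is obtained from `φ` by folding over the corner at the vertex `v`: for some line in the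
image plane, those points of a neighbourhood `U` of `v` whose images lie on the same side of the
line as the images of all points close to `v` are reflected across the line. No vertex point
other than `v` lies in `U`. -/
def FoldsCornerOver (φ : ℂ → ℂ) (v : FoldVertex φ) (ψ : ℂ → ℂ) : Prop :=
  ∃ (n : ℂ) (c : ℝ) (U : Set ℂ), ‖n‖ = 1 ∧ U ∈ v.nhds ∧
    (∀ q (hq : IsVertexPoint φ q), q ∈ U → v = FoldVertex.point q hq) ∧
    (∀ᶠ x in v.nhds, c < inner ℝ n (φ x)) ∧
    (∀ x ∈ U, c < inner ℝ n (φ x) → ψ x = reflectAcross n c (φ x)) ∧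
    (∀ x, ¬ (x ∈ U ∧ c < inner ℝ n (φ x)) → ψ x = φ x)

/-! The proof is an induction over wheel replacements, carried by one local picture. Every vertex
that occurs has degree four: the dipole is 4-regular, a wheel put in place of a vertex of degree
four has a hub of degree four, and cycle vertices always have degree four. Correspondingly, near
each vertex the folding is, up to an isometry of the image and a translation of the source, a
`coneFold m n`: two successive folds along lines through the origin, whose creases are four rays
(`IsCone`). The vertex ∞ is treated in the same way: all rays to infinity are kept on lines through
the origin, so that outside a compact set the folding is a cone with apex 0, traversed with opposite
orientation. `FoldModel` packages this local information with the correspondence of vertices and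
darts and is the induction hypothesis.

The decisive fact is `IsCone.exists_axis`: the image of a four-sector cone lies in a wedge of
opening angle less than π, so along a suitable axis the height of the image of `z` is at least `μ *
‖z‖` with `μ > 0`. The height is positively homogeneous, and linear on each sector. Its level set at
`c > 0` is therefore a quadrilateral around the apex with one corner on each crease. Reflecting the
image of the inside of this quadrilateral (of the outside, if the vertex is ∞) turns its sides into
creases and its corners into vertices. Each crease at the vertex is cut into a spoke and a remaining
old edge. This is exactly a wheel.

The induction hypothesis survives. At a corner of the quadrilateral the new map is the fold along
the old crease followed by the fold along the new line, again a four-sector cone (`IsCone.corner`,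
`CornerCut.exists_cone_corner`). At the hub the old cone is followed by a reflection, and near all
other vertices nothing changes if the line is close enough to the corner
(`FoldModel.exists_isSmall`). Away from the folding line the map is locally only followed by an
isometry, which preserves the type of a point. `CornerCut.wheelModel` collects this.

A model determines the whole graph (`FoldModel.realization`): an edge must leave a vertex point
along a crease of its cone, so there are no further edges, and the orientation of consecutive
creases gives the cyclic order. The global wedge comes from the cone at ∞, with its apex pushed back
to absorb a compact set (`FoldModel.imageInWedge`). -/

/-! ## Folding along a line through the origin -/

/-- The reflection of the plane across the line orthogonal to `n`. -/
noncomputable def mirror (n : ℂ) : ℂ ≃ₗᵢ[ℝ] ℂ := (Submodule.span ℝ {n})ᗮ.reflection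

theorem mirror_apply {n : ℂ} (hn : ‖n‖ = 1) (z : ℂ) :
    mirror n z = z - (2 * inner ℝ n z : ℝ) • n := by
  rw [mirror, Submodule.reflection_orthogonal_apply, Submodule.reflection_singleton_apply, hn]
  simp only [RCLike.ofReal_real_eq_id, id, one_pow, div_one, neg_sub, two_smul, two_mul, add_smul]

/-- The fold of the plane along the line orthogonal to `n`, which moves the side into which `n`
points onto the other side. -/
noncomputable def halfFold (n z : ℂ) : ℂ := z - (2 * max (inner ℝ n z) 0 : ℝ) • n

theorem halfFold_of_nonpos {n z : ℂ} (h : inner ℝ n z ≤ 0) : halfFold n z = z := by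
  rw [halfFold, max_eq_right h, mul_zero, zero_smul, sub_zero]

theorem halfFold_of_nonneg {n z : ℂ} (hn : ‖n‖ = 1) (h : 0 ≤ inner ℝ n z) :
    halfFold n z = mirror n z := by
  rw [halfFold, max_eq_left h, mirror_apply hn]

@[fun_prop]
theorem continuous_halfFold (n : ℂ) : Continuous (halfFold n) := by
  unfold halfFold
  fun_prop

@[simp]
theorem halfFold_zero (n : ℂ) : halfFold n 0 = 0 := by simp [halfFold]

theorem inner_mirror {n : ℂ} (hn : ‖n‖ = 1) (z : ℂ) : inner ℝ n (mirror n z) = -inner ℝ n z := by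
  rw [mirror_apply hn, inner_sub_right, real_inner_smul_right, real_inner_self_eq_norm_sq, hn]
  ring

theorem mirror_mirror (n z : ℂ) : mirror n (mirror n z) = z :=
  Submodule.reflection_reflection _ z

theorem halfFold_eq_or {n : ℂ} (hn : ‖n‖ = 1) (z : ℂ) :
    halfFold n z = z ∧ inner ℝ n z ≤ 0 ∨ halfFold n z = mirror n z ∧ 0 ≤ inner ℝ n z := by
  rcases le_total (inner ℝ n z) 0 with h | h
  · exact Or.inl ⟨halfFold_of_nonpos h, h⟩
  · exact Or.inr ⟨halfFold_of_nonneg hn h, h⟩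

theorem inner_halfFold_nonpos {n : ℂ} (hn : ‖n‖ = 1) (z : ℂ) : inner ℝ n (halfFold n z) ≤ 0 := by
  rcases halfFold_eq_or hn z with ⟨h, h'⟩ | ⟨h, h'⟩
  · rwa [h]
  · rw [h, inner_mirror hn]
    linarith

theorem norm_halfFold {n : ℂ} (hn : ‖n‖ = 1) (z : ℂ) : ‖halfFold n z‖ = ‖z‖ := by
  rcases halfFold_eq_or hn z with ⟨h, -⟩ | ⟨h, -⟩ <;> rw [h]
  exact (mirror n).norm_map z

theorem halfFold_smul (n z : ℂ) {t : ℝ} (ht : 0 ≤ t) : halfFold n (t • z) = t • halfFold n z := by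
  have : max (t * inner ℝ n z) 0 = t * max (inner ℝ n z) 0 := by
    rw [mul_max_of_nonneg _ _ ht, mul_zero]
  rw [halfFold, halfFold, real_inner_smul_right, this, smul_sub, smul_smul]
  ring_nf

/-- The hypothesis places both vectors in one closed side of the line, where the fold is linear. -/
theorem halfFold_add {n x y : ℂ} (h : 0 ≤ inner ℝ n x * inner ℝ n y) :
    halfFold n (x + y) = halfFold n x + halfFold n y := by
  have key : max (inner ℝ n x + inner ℝ n y) 0 = max (inner ℝ n x) 0 + max (inner ℝ n y) 0 := by
    rcases mul_nonneg_iff.1 h with ⟨h1, h2⟩ | ⟨h1, h2⟩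
    · rw [max_eq_left h1, max_eq_left h2, max_eq_left (add_nonneg h1 h2)]
    · rw [max_eq_right h1, max_eq_right h2, max_eq_right (add_nonpos h1 h2), add_zero]
  simp only [halfFold, inner_add_right, key, mul_add, add_smul]
  abel

/-- Choosing the other side as the moving one changes the fold only by an isometry of the image.
Hence the sign of a normal vector can be prescribed at will. -/
theorem halfFold_neg {n : ℂ} (hn : ‖n‖ = 1) (z : ℂ) :
    halfFold (-n) z = mirror n (halfFold n z) := by
  rcases le_total (inner ℝ n z) 0 with h | h
  · have h' : 0 ≤ inner ℝ (-n) z := by rw [inner_neg_left]; linarith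
    rw [halfFold_of_nonpos h, halfFold_of_nonneg (by rwa [norm_neg]) h',
      mirror_apply (by rwa [norm_neg]), mirror_apply hn, inner_neg_left, smul_neg, mul_neg,
      neg_smul, neg_neg]
  · have h' : inner ℝ (-n) z ≤ 0 := by rw [inner_neg_left]; linarith
    rw [halfFold_of_nonpos h', halfFold_of_nonneg hn h, mirror_mirror]

theorem halfFold_map (L : ℂ ≃ₗᵢ[ℝ] ℂ) (n z : ℂ) : halfFold (L n) (L z) = L (halfFold n z) := by
  rw [halfFold, halfFold, L.inner_map_map, map_sub, map_smul]

/-- Folding after an isometry is folding along the pulled-back line before it. This brings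
compositions into the normal form "isometry after fold". -/
theorem halfFold_eq_map (L : ℂ ≃ₗᵢ[ℝ] ℂ) (n z : ℂ) :
    halfFold n (L z) = L (halfFold (L.symm n) z) := by
  rw [← halfFold_map, L.apply_symm_apply]

/-- Off its line, a fold agrees locally with a linear isometry. -/
theorem halfFold_eventually {n z : ℂ} (hn : ‖n‖ = 1) (h : inner ℝ n z ≠ 0) :
    ∃ B : ℂ ≃ₗᵢ[ℝ] ℂ, (∀ᶠ x in 𝓝 z, halfFold n x = B x) ∧
      ∀ x, 0 ≤ inner ℝ n x * inner ℝ n z → halfFold n x = B x := by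
  have hc : Continuous fun x : ℂ => inner ℝ n x := by fun_prop
  rcases h.lt_or_gt with h | h
  · have key : ∀ x, inner ℝ n x ≤ 0 → halfFold n x = LinearIsometryEquiv.refl ℝ ℂ x :=
      fun x hx => halfFold_of_nonpos hx
    refine ⟨LinearIsometryEquiv.refl ℝ ℂ, ?_, fun x hx => key x ?_⟩
    · filter_upwards [hc.continuousAt.eventually_lt continuousAt_const h] with x hx
      exact key x hx.le
    · by_contra! hx'
      nlinarith
  · have key : ∀ x, 0 ≤ inner ℝ n x → halfFold n x = mirror n x :=
      fun x hx => halfFold_of_nonneg hn hx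
    refine ⟨mirror n, ?_, fun x hx => key x ?_⟩
    · filter_upwards [continuousAt_const.eventually_lt hc.continuousAt h] with x hx
      exact key x hx.le
    · by_contra! hx'
      nlinarith

/-! ## Recognizing the three types of points -/

/-- The isometry `z ↦ b + L (z - p)`. -/
noncomputable def isometryAt (p b : ℂ) (L : ℂ ≃ₗᵢ[ℝ] ℂ) : ℂ ≃ᵢ ℂ :=
  ((IsometryEquiv.addRight (-p)).trans L.toIsometryEquiv).trans (IsometryEquiv.addLeft b)

theorem isometryAt_apply (p b : ℂ) (L : ℂ ≃ₗᵢ[ℝ] ℂ) (z : ℂ) :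
    isometryAt p b L z = b + L (z - p) := by
  simp [isometryAt, sub_eq_add_neg]

theorem isometryAt_injective (p b : ℂ) : Function.Injective (isometryAt p b) := by
  intro L M h
  ext z
  have := congrArg (fun f : ℂ ≃ᵢ ℂ => f (z + p)) h
  simpa [isometryAt_apply] using this

theorem isUnfoldedPoint_of_eventually {φ : ℂ → ℂ} {p b : ℂ} {L : ℂ ≃ₗᵢ[ℝ] ℂ}
    (h : ∀ᶠ x in 𝓝 p, φ x = b + L (x - p)) : IsUnfoldedPoint φ p := by
  refine ⟨_, h, fun x hx y hy => ?_⟩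
  rw [show φ x = _ from hx, show φ y = _ from hy, ← isometryAt_apply, ← isometryAt_apply]
  exact (isometryAt p b L).isometry.dist_eq x y

theorem mirror_self {n : ℂ} (hn : ‖n‖ = 1) : mirror n n = -n := by
  rw [mirror_apply hn, real_inner_self_eq_norm_sq, hn]
  norm_num [two_smul]

theorem mirror_ne_self {n z : ℂ} (hn : ‖n‖ = 1) (h : inner ℝ n z ≠ 0) : mirror n z ≠ z := by
  intro h'
  have := inner_mirror hn z
  rw [h'] at this
  exact h (by linarith)

theorem eventually_smul_add {P : ℂ → Prop} {p : ℂ} (h : ∀ᶠ x in 𝓝 p, P x) (z : ℂ) :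
    ∀ᶠ t : ℝ in 𝓝[>] 0, P (p + t • z) := by
  have : Tendsto (fun t : ℝ => p + t • z) (𝓝[>] 0) (𝓝 p) := by
    have hc : Continuous fun t : ℝ => p + t • z := by fun_prop
    simpa using (hc.tendsto 0).mono_left nhdsWithin_le_nhds
  exact this.eventually h

/-- Two different rays from `p` with the same image contain, arbitrarily close to `p`, different
points that are identified. -/
theorem not_isUnfoldedPoint {φ : ℂ → ℂ} {p b : ℂ} {K : ℂ → ℂ}
    (h : ∀ᶠ x in 𝓝 p, φ x = b + K (x - p)) {y z : ℂ} (hyz : y ≠ z)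
    (hK : ∀ t : ℝ, 0 < t → K (t • y) = K (t • z)) : ¬ IsUnfoldedPoint φ p := by
  rintro ⟨N, hN, hiso⟩
  obtain ⟨t, ⟨⟨⟨⟨h1, h2⟩, h3⟩, h4⟩, h5⟩⟩ := (((((eventually_smul_add h y).and
    (eventually_smul_add h z)).and (eventually_smul_add hN y)).and
    (eventually_smul_add hN z)).and self_mem_nhdsWithin).exists
  have h6 : (0 : ℝ) < t := h5
  have := hiso _ h3 _ h4
  rw [h1, h2, add_sub_cancel_left, add_sub_cancel_left, hK t h6, dist_self, eq_comm, dist_eq_zero,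
    add_right_inj] at this
  exact hyz (smul_right_injective ℂ h6.ne' this)

/-- The rays along `n` and `-n` are identified, and the two closed half planes carry the two
isometries. -/
theorem isCreasePoint_of_eventually {φ : ℂ → ℂ} {p b n : ℂ} {L : ℂ ≃ₗᵢ[ℝ] ℂ} (hn : ‖n‖ = 1)
    (h : ∀ᶠ x in 𝓝 p, φ x = b + L (halfFold n (x - p))) : IsCreasePoint φ p := by
  have hnn : inner ℝ n n = (1 : ℝ) := by rw [real_inner_self_eq_norm_sq, hn]; norm_num
  refine ⟨not_isUnfoldedPoint (K := fun z => L (halfFold n z)) h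
    (mirror_ne_self hn (z := n) (by rw [hnn]; norm_num)).symm fun t ht => ?_, ?_⟩
  · rw [halfFold_of_nonneg hn, halfFold_of_nonpos, map_smul]
    · rw [real_inner_smul_right, inner_mirror hn, hnn]; linarith
    · rw [real_inner_smul_right, hnn]; linarith
  · refine ⟨![{x | φ x = b + L (halfFold n (x - p)) ∧ inner ℝ n (x - p) ≤ 0},
      {x | φ x = b + L (halfFold n (x - p)) ∧ 0 ≤ inner ℝ n (x - p)}],
      ![isometryAt p b L, isometryAt p b ((mirror n).trans L)], ?_, ?_, ?_⟩
    · intro h'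
      have h2 := isometryAt_injective p b h'
      have h3 := congrArg (fun f : ℂ ≃ₗᵢ[ℝ] ℂ => f n) h2
      exact mirror_ne_self hn (z := n) (by rw [hnn]; norm_num) (L.injective (by simpa using h3.symm))
    · filter_upwards [h] with x hx
      rw [mem_iUnion]
      rcases le_total (inner ℝ n (x - p)) 0 with h' | h'
      · exact ⟨0, hx, h'⟩
      · exact ⟨1, hx, h'⟩
    · have hp := h.self_of_nhds
      intro i
      fin_cases i
      · refine ⟨⟨hp, by simp⟩, fun x hx => ?_⟩
        obtain ⟨hx1, hx2⟩ := hx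
        simp [isometryAt_apply, hx1, halfFold_of_nonpos hx2]
      · refine ⟨⟨hp, by simp⟩, fun x hx => ?_⟩
        obtain ⟨hx1, hx2⟩ := hx
        simp [isometryAt_apply, hx1, halfFold_of_nonneg hn hx2]

/-- A map that locally takes at most two values per pair of isometries cannot identify three
points. -/
theorem not_isCreasePoint {φ : ℂ → ℂ} {p b : ℂ} {K : ℂ → ℂ}
    (h : ∀ᶠ x in 𝓝 p, φ x = b + K (x - p)) {z : Fin 3 → ℂ} (hz : Function.Injective z)
    (hK : ∀ t : ℝ, 0 < t → ∀ i j, K (t • z i) = K (t • z j)) : ¬ IsCreasePoint φ p := by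
  rintro ⟨-, A, f, -, hA, hAf⟩
  have hev : ∀ᶠ t : ℝ in 𝓝[>] 0, ∀ i, φ (p + t • z i) = b + K (p + t • z i - p) ∧
      p + t • z i ∈ ⋃ i, A i :=
    eventually_all.2 fun i => (eventually_smul_add h (z i)).and (eventually_smul_add hA (z i))
  obtain ⟨t, ht, h0⟩ := (hev.and self_mem_nhdsWithin).exists
  have h0 : (0 : ℝ) < t := h0
  choose hφ hmem using ht
  simp only [mem_iUnion] at hmem
  choose s hs using hmem
  -- By pigeonhole, two of the three points lie in one covering set, whose isometry would have to
  -- identify them.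
  obtain ⟨i, j, hij, hsij⟩ := Fintype.exists_ne_map_eq_of_card_lt s (by simp)
  have h1 := (hAf (s i)).2 (hs i)
  have h2 := (hAf (s j)).2 (hs j)
  rw [hφ, add_sub_cancel_left] at h1 h2
  rw [hK t h0 i j, h2, ← hsij] at h1
  have := (f (s i)).injective h1
  rw [add_right_inj] at this
  exact hij (hz (smul_right_injective ℂ h0.ne' this.symm))

/-- The vector `v` lies on the second line, strictly inside the side that the first fold leaves in
place. A vector `y` near `v`, its mirror image in the second line and its mirror image in the first
line are three different vectors with the same image, so two isometries cannot suffice. -/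
theorem isVertexPoint_of_eventually {φ : ℂ → ℂ} {p b m n v : ℂ} {L : ℂ ≃ₗᵢ[ℝ] ℂ} (hm : ‖m‖ = 1)
    (hn : ‖n‖ = 1) (hmv : inner ℝ m v < 0) (hnv : inner ℝ n v = 0)
    (h : ∀ᶠ x in 𝓝 p, φ x = b + L (halfFold n (halfFold m (x - p)))) : IsVertexPoint φ p := by
  have hnn : inner ℝ n n = (1 : ℝ) := by rw [real_inner_self_eq_norm_sq, hn]; norm_num
  -- The displacement is so small that both `v + η • n` and its mirror image stay on the side not
  -- moved by the first fold.
  obtain ⟨η, h1, h2, hη⟩ : ∃ η : ℝ, inner ℝ m (v + η • n) < 0 ∧ inner ℝ m (v + (-η) • n) < 0 ∧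
      0 < η := by
    have hc : ∀ s : ℝ, ∀ᶠ η : ℝ in 𝓝[>] 0, inner ℝ m (v + η • (s • n)) < 0 := fun s =>
      eventually_smul_add (P := fun x => inner ℝ m x < 0)
        ((by fun_prop : Continuous fun x : ℂ => inner ℝ m x).continuousAt.eventually_lt
          continuousAt_const hmv) (s • n)
    obtain ⟨η, ⟨h1, h2⟩, h3⟩ := (((hc 1).and (hc (-1))).and self_mem_nhdsWithin).exists
    exact ⟨η, by simpa using h1, by simpa using h2, h3⟩
  set y := v + η • n with hy
  have hny : inner ℝ n y = η := by
    rw [hy, inner_add_right, real_inner_smul_right, hnv, hnn]; ring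
  have hmy : mirror n y = v + (-η) • n := by
    rw [mirror_apply hn, hny, hy]; module
  have hK1 : halfFold n (halfFold m y) = mirror n y := by
    rw [halfFold_of_nonpos h1.le, halfFold_of_nonneg hn (by rw [hny]; exact hη.le)]
  have hK2 : halfFold n (halfFold m (mirror n y)) = mirror n y := by
    rw [halfFold_of_nonpos (z := mirror n y) (by rw [hmy]; exact h2.le), halfFold_of_nonpos]
    rw [inner_mirror hn, hny]; linarith
  have hK3 : halfFold n (halfFold m (mirror m y)) = mirror n y := by
    rw [halfFold_of_nonneg hm (z := mirror m y) (by rw [inner_mirror hm]; linarith),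
      mirror_mirror, halfFold_of_nonneg hn (by rw [hny]; exact hη.le)]
  have e1 : mirror n y ≠ y := mirror_ne_self hn (by rw [hny]; exact hη.ne')
  have e2 : mirror m y ≠ y := mirror_ne_self hm h1.ne
  have e3 : mirror n y ≠ mirror m y := fun e => by
    have := inner_mirror hm y
    rw [← e, hmy] at this
    linarith
  have hK : ∀ i, halfFold n (halfFold m ((![y, mirror n y, mirror m y] : Fin 3 → ℂ) i))
      = mirror n y := by
    intro i; fin_cases i
    exacts [hK1, hK2, hK3]
  have hinj : Function.Injective (![y, mirror n y, mirror m y] : Fin 3 → ℂ) := by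
    intro i j hij
    fin_cases i <;> fin_cases j
    exacts [rfl, (e1 hij.symm).elim, (e2 hij.symm).elim, (e1 hij).elim, rfl, (e3 hij).elim,
      (e2 hij).elim, (e3 hij.symm).elim, rfl]
  refine ⟨not_isUnfoldedPoint (K := fun z => L (halfFold n (halfFold m z))) h e1.symm ?_,
    not_isCreasePoint (K := fun z => L (halfFold n (halfFold m z))) h hinj ?_, ?_⟩
  · intro t ht
    simp only [halfFold_smul _ _ ht.le, hK1, hK2]
  · intro t ht i j
    simp only [halfFold_smul _ _ ht.le, hK]
  -- Each fold either moves a point or not, which gives four isometries. The first three are told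
  -- apart by their values at `y`; the fourth is needed only for covering.
  · refine ⟨4, fun i => {x | φ x = b + L (halfFold n (halfFold m (x - p))) ∧
        φ x = isometryAt p b ((![LinearIsometryEquiv.refl ℝ ℂ, mirror n, mirror m,
          (mirror m).trans (mirror n)] i).trans L) x},
      fun i => isometryAt p b ((![LinearIsometryEquiv.refl ℝ ℂ, mirror n, mirror m,
          (mirror m).trans (mirror n)] i).trans L), ?_, ?_, ?_⟩
    · have hinj' : ∀ M M' : ℂ ≃ₗᵢ[ℝ] ℂ, isometryAt p b (M.trans L) = isometryAt p b (M'.trans L) →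
          M y = M' y := by
        intro M M' hM
        have h3 := congrArg (fun f : ℂ ≃ₗᵢ[ℝ] ℂ => f y) (isometryAt_injective p b hM)
        exact L.injective h3
      let F : (ℂ ≃ₗᵢ[ℝ] ℂ) → (ℂ ≃ᵢ ℂ) := fun M => isometryAt p b (M.trans L)
      have hsub : ({F (LinearIsometryEquiv.refl ℝ ℂ), F (mirror n), F (mirror m)} : Set _) ⊆
          range fun i : Fin 4 => isometryAt p b ((![LinearIsometryEquiv.refl ℝ ℂ, mirror n, mirror m,
          (mirror m).trans (mirror n)] i).trans L) := by
        rintro f (rfl | rfl | rfl)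
        exacts [⟨0, rfl⟩, ⟨1, rfl⟩, ⟨2, rfl⟩]
      refine le_trans (le_of_eq ?_) (ncard_le_ncard hsub (finite_range _))
      rw [eq_comm, ncard_eq_three]
      exact ⟨_, _, _, fun e => e1 (hinj' _ _ e).symm, fun e => e2 (hinj' _ _ e).symm,
        fun e => e3 (hinj' _ _ e), rfl⟩
    · filter_upwards [h] with x hx
      rw [mem_iUnion]
      rcases halfFold_eq_or hm (x - p) with ⟨hm', -⟩ | ⟨hm', -⟩ <;>
        rcases halfFold_eq_or hn (halfFold m (x - p)) with ⟨hn', -⟩ | ⟨hn', -⟩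
      · exact ⟨0, hx, by rw [hx, hn', hm', isometryAt_apply]; rfl⟩
      · exact ⟨1, hx, by rw [hx, hn', hm', isometryAt_apply]; rfl⟩
      · exact ⟨2, hx, by rw [hx, hn', hm', isometryAt_apply]; rfl⟩
      · exact ⟨3, hx, by rw [hx, hn', hm', isometryAt_apply]; rfl⟩
    · intro i
      refine ⟨⟨h.self_of_nhds, ?_⟩, fun x hx => hx.2⟩
      rw [h.self_of_nhds, isometryAt_apply]
      simp

/-! ## Isometries of the image plane -/

section comp

variable {φ ψ : ℂ → ℂ} {p : ℂ} {σ : ℂ ≃ᵢ ℂ}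

/-- This and its analogues below show that the type of a point is unchanged wherever a new fold acts
locally as a single isometry of the image, that is, off the folding line. -/
theorem IsUnfoldedPoint.comp_isometry (hφ : IsUnfoldedPoint φ p) (h : ∀ᶠ x in 𝓝 p, ψ x = σ (φ x)) :
    IsUnfoldedPoint ψ p := by
  obtain ⟨N, hN, hiso⟩ := hφ
  refine ⟨_, inter_mem hN h, fun x hx y hy => ?_⟩
  rw [show ψ x = _ from hx.2, show ψ y = _ from hy.2, σ.dist_eq, hiso x hx.1 y hy.1]

theorem IsLocalCover.comp_isometry {k : ℕ} {A : Fin k → Set ℂ} {f : Fin k → (ℂ ≃ᵢ ℂ)}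
    (hφ : IsLocalCover φ p A f) (h : ∀ᶠ x in 𝓝 p, ψ x = σ (φ x)) :
    IsLocalCover ψ p (fun i => A i ∩ {x | ψ x = σ (φ x)}) (fun i => (f i).trans σ) := by
  refine ⟨?_, fun i => ⟨⟨(hφ.2 i).1, h.self_of_nhds⟩, fun x hx => ?_⟩⟩
  · rw [← iUnion_inter]
    exact inter_mem hφ.1 h
  · rw [show ψ x = _ from hx.2, (hφ.2 i).2 hx.1]
    rfl

theorem eventually_symm_comp (h : ∀ᶠ x in 𝓝 p, ψ x = σ (φ x)) :
    ∀ᶠ x in 𝓝 p, φ x = σ.symm (ψ x) := by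
  filter_upwards [h] with x hx
  rw [hx, σ.symm_apply_apply]

theorem trans_isometry_injective (σ : ℂ ≃ᵢ ℂ) :
    Function.Injective fun f : ℂ ≃ᵢ ℂ => f.trans σ := by
  intro f g h
  ext z
  exact σ.injective (congrArg (fun f : ℂ ≃ᵢ ℂ => f z) h)

theorem IsCreasePoint.comp_isometry (hφ : IsCreasePoint φ p) (h : ∀ᶠ x in 𝓝 p, ψ x = σ (φ x)) :
    IsCreasePoint ψ p := by
  obtain ⟨hu, A, f, hf, hA⟩ := hφ
  exact ⟨fun h' => hu (h'.comp_isometry (eventually_symm_comp h)), _, _,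
    fun e => hf (trans_isometry_injective σ e), hA.comp_isometry h⟩

theorem IsVertexPoint.comp_isometry (hφ : IsVertexPoint φ p) (h : ∀ᶠ x in 𝓝 p, ψ x = σ (φ x)) :
    IsVertexPoint ψ p := by
  obtain ⟨hu, hc, k, A, f, hf, hA⟩ := hφ
  refine ⟨fun h' => hu (h'.comp_isometry (eventually_symm_comp h)),
    fun h' => hc (h'.comp_isometry (eventually_symm_comp h)), k, _, _, ?_, hA.comp_isometry h⟩
  have : (range fun i => (f i).trans σ) = (fun f : ℂ ≃ᵢ ℂ => f.trans σ) '' range f := by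
    rw [← range_comp]; rfl
  rwa [this, ncard_image_of_injective _ (trans_isometry_injective σ)]

end comp

/-! ## Four-sector cones -/

/-- The fold along two successive lines through the origin. -/
noncomputable def coneFold (m n z : ℂ) : ℂ := halfFold n (halfFold m z)

/-- The vectors `u 0, …, u 3` point along the four creases of `coneFold m n`, in cyclic order. -/
structure IsCone (m n : ℂ) (u : Fin 4 → ℂ) : Prop where
  norm_m : ‖m‖ = 1
  norm_n : ‖n‖ = 1
  m0 : inner ℝ m (u 0) = 0
  m1 : inner ℝ m (u 1) < 0
  m2 : inner ℝ m (u 2) = 0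
  m3 : 0 < inner ℝ m (u 3)
  n1 : inner ℝ n (u 1) = 0
  n3 : inner ℝ n (halfFold m (u 3)) = 0
  n02 : inner ℝ n (u 0) * inner ℝ n (u 2) < 0

/-- Two vectors that bound a sector on which `coneFold m n` is linear. -/
structure IsSector (m n x y : ℂ) : Prop where
  m_nonneg : 0 ≤ inner ℝ m x * inner ℝ m y
  m_ne : inner ℝ m x ≠ 0 ∨ inner ℝ m y ≠ 0
  n_nonneg : 0 ≤ inner ℝ n (halfFold m x) * inner ℝ n (halfFold m y)
  n_ne : inner ℝ n (halfFold m x) ≠ 0 ∨ inner ℝ n (halfFold m y) ≠ 0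

theorem Fin.forall_four {P : Fin 4 → Prop} (h0 : P 0) (h1 : P 1) (h2 : P 2) (h3 : P 3) :
    ∀ i, P i := by
  intro i
  fin_cases i <;> assumption

@[fun_prop]
theorem continuous_coneFold (m n : ℂ) : Continuous (coneFold m n) := by
  unfold coneFold
  fun_prop

@[simp]
theorem coneFold_zero (m n : ℂ) : coneFold m n 0 = 0 := by simp [coneFold]

theorem coneFold_smul (m n z : ℂ) {t : ℝ} (ht : 0 ≤ t) :
    coneFold m n (t • z) = t • coneFold m n z := by
  rw [coneFold, halfFold_smul _ _ ht, halfFold_smul _ _ ht, coneFold]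

theorem exists_smul_of_inner_eq_zero {k x z : ℂ} (hk : k ≠ 0) (hx : x ≠ 0)
    (hkx : inner ℝ k x = 0) (hkz : inner ℝ k z = 0) : ∃ t : ℝ, z = t • x := by
  rw [Complex.inner] at hkx hkz
  simp only [Complex.mul_re, Complex.conj_re, Complex.conj_im] at hkx hkz
  have hx' : x.re ^ 2 + x.im ^ 2 ≠ 0 := by
    intro h
    apply hx
    apply Complex.ext <;> simp <;> nlinarith [sq_nonneg x.re, sq_nonneg x.im]
  have hdet : x.re * z.im = x.im * z.re := by
    by_contra hne
    have h1 : k.re * (x.re * z.im - x.im * z.re) = 0 := by linear_combination z.im * hkx - x.im * hkz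
    have h2 : k.im * (x.re * z.im - x.im * z.re) = 0 := by linear_combination x.re * hkz - z.re * hkx
    have h0 := sub_ne_zero.2 hne
    exact hk (Complex.ext (by simpa [h0] using h1) (by simpa [h0] using h2))
  refine ⟨(x.re * z.re + x.im * z.im) / (x.re ^ 2 + x.im ^ 2), Complex.ext ?_ ?_⟩
  · rw [Complex.smul_re, smul_eq_mul]
    field_simp
    linear_combination (-x.im) * hdet
  · rw [Complex.smul_im, smul_eq_mul]
    field_simp
    linear_combination x.re * hdet

theorem inner_ne_zero_of_combo {a b s t : ℝ} (h : 0 ≤ a * b) (h' : a ≠ 0 ∨ b ≠ 0) (hs : 0 < s)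
    (ht : 0 < t) : s * a + t * b ≠ 0 := by
  intro e
  have h1 : a = -(t * b) / s := by field_simp; linarith
  have hb : b = 0 := by
    by_contra hb
    have : a * b = -(t * b ^ 2 / s) := by rw [h1]; ring
    have : 0 < t * b ^ 2 / s := by positivity
    linarith
  have ha : a = 0 := by rw [h1, hb]; simp
  exact h'.elim (· ha) (· hb)

namespace IsSector

variable {m n x y : ℂ}

theorem halfFold_combo (h : IsSector m n x y) {s t : ℝ} (hs : 0 ≤ s) (ht : 0 ≤ t) :
    halfFold m (s • x + t • y) = s • halfFold m x + t • halfFold m y := by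
  rw [halfFold_add, halfFold_smul _ _ hs, halfFold_smul _ _ ht]
  rw [real_inner_smul_right, real_inner_smul_right, mul_mul_mul_comm]
  exact mul_nonneg (mul_nonneg hs ht) h.m_nonneg

/-- Neither folding line separates the two bounding vectors, at the stage at which it is used. Both
folds are therefore linear on the sector. -/
theorem coneFold_combo (h : IsSector m n x y) {s t : ℝ} (hs : 0 ≤ s) (ht : 0 ≤ t) :
    coneFold m n (s • x + t • y) = s • coneFold m n x + t • coneFold m n y := by
  rw [coneFold, h.halfFold_combo hs ht, halfFold_add, halfFold_smul _ _ hs, halfFold_smul _ _ ht]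
  · rfl
  rw [real_inner_smul_right, real_inner_smul_right, mul_mul_mul_comm]
  exact mul_nonneg (mul_nonneg hs ht) h.n_nonneg

theorem combo_m_ne (h : IsSector m n x y) {s t : ℝ} (hs : 0 < s) (ht : 0 < t) :
    inner ℝ m (s • x + t • y) ≠ 0 := by
  rw [inner_add_right, real_inner_smul_right, real_inner_smul_right]
  exact inner_ne_zero_of_combo h.m_nonneg h.m_ne hs ht

theorem combo_n_ne (h : IsSector m n x y) {s t : ℝ} (hs : 0 < s) (ht : 0 < t) :
    inner ℝ n (halfFold m (s • x + t • y)) ≠ 0 := by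
  rw [h.halfFold_combo hs.le ht.le, inner_add_right, real_inner_smul_right, real_inner_smul_right]
  exact inner_ne_zero_of_combo h.n_nonneg h.n_ne hs ht

end IsSector

/-- Off its creases, `coneFold m n` agrees locally with a linear isometry. -/
theorem coneFold_eventually {m n z : ℂ} (hm : ‖m‖ = 1) (hn : ‖n‖ = 1) (hmz : inner ℝ m z ≠ 0)
    (hnz : inner ℝ n (halfFold m z) ≠ 0) :
    ∃ B : ℂ ≃ₗᵢ[ℝ] ℂ, ∀ᶠ x in 𝓝 z, coneFold m n x = B x := by
  obtain ⟨R, hR, -⟩ := halfFold_eventually hm hmz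
  obtain ⟨S, hS, -⟩ := halfFold_eventually hn hnz
  refine ⟨R.trans S, ?_⟩
  filter_upwards [hR, (continuous_halfFold m).continuousAt.eventually hS] with x h1 h2
  rw [coneFold, h2, h1]
  rfl

namespace IsCone

variable {m n : ℂ} {u : Fin 4 → ℂ}

/-- Only the rays matter. The same cone can be presented by directions of darts or by the corners of
a quadrilateral around its apex. -/
theorem smul (h : IsCone m n u) {r : Fin 4 → ℝ} (hr : ∀ i, 0 < r i) :
    IsCone m n fun i => r i • u i where
  norm_m := h.norm_m
  norm_n := h.norm_n
  m0 := by rw [real_inner_smul_right, h.m0, mul_zero]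
  m1 := by rw [real_inner_smul_right]; exact mul_neg_of_pos_of_neg (hr 1) h.m1
  m2 := by rw [real_inner_smul_right, h.m2, mul_zero]
  m3 := by rw [real_inner_smul_right]; exact mul_pos (hr 3) h.m3
  n1 := by rw [real_inner_smul_right, h.n1, mul_zero]
  n3 := by rw [halfFold_smul _ _ (hr 3).le, real_inner_smul_right, h.n3, mul_zero]
  n02 := by
    rw [real_inner_smul_right, real_inner_smul_right, mul_mul_mul_comm]
    exact mul_neg_of_pos_of_neg (mul_pos (hr 0) (hr 2)) h.n02

theorem n0 (h : IsCone m n u) : inner ℝ n (u 0) ≠ 0 := left_ne_zero_of_mul h.n02.ne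

theorem n2 (h : IsCone m n u) : inner ℝ n (u 2) ≠ 0 := right_ne_zero_of_mul h.n02.ne

theorem halfFold_u0 (h : IsCone m n u) : halfFold m (u 0) = u 0 := halfFold_of_nonpos h.m0.le

theorem halfFold_u1 (h : IsCone m n u) : halfFold m (u 1) = u 1 := halfFold_of_nonpos h.m1.le

theorem halfFold_u2 (h : IsCone m n u) : halfFold m (u 2) = u 2 := halfFold_of_nonpos h.m2.le

theorem ne_zero (h : IsCone m n u) : ∀ i, u i ≠ 0 := by
  have key : ∀ {k z : ℂ}, inner ℝ k z ≠ (0 : ℝ) → z ≠ 0 := by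
    rintro k z hz rfl
    exact hz (inner_zero_right k)
  exact Fin.forall_four (key h.n0) (key h.m1.ne) (key h.n2) (key h.m3.ne')

theorem m_ne_zero (h : IsCone m n u) : m ≠ 0 := norm_ne_zero_iff.1 (by rw [h.norm_m]; norm_num)

theorem n_ne_zero (h : IsCone m n u) : n ≠ 0 := norm_ne_zero_iff.1 (by rw [h.norm_n]; norm_num)

theorem isSector (h : IsCone m n u) : ∀ i, IsSector m n (u i) (u (i + 1)) := by
  refine Fin.forall_four ⟨?_, Or.inr h.m1.ne, ?_, ?_⟩ ⟨?_, Or.inl h.m1.ne, ?_, ?_⟩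
    ⟨?_, Or.inr h.m3.ne', ?_, ?_⟩ ⟨?_, Or.inl h.m3.ne', ?_, ?_⟩
  · rw [h.m0, zero_mul]
  · rw [h.halfFold_u0, show (0 + 1 : Fin 4) = 1 from rfl, h.halfFold_u1, h.n1, mul_zero]
  · exact Or.inl ((congrArg (inner ℝ n) h.halfFold_u0).trans_ne h.n0)
  · rw [show (1 + 1 : Fin 4) = 2 from rfl, h.m2, mul_zero]
  · rw [h.halfFold_u1, h.n1, zero_mul]
  · exact Or.inr ((congrArg (inner ℝ n) h.halfFold_u2).trans_ne h.n2)
  · rw [h.m2, zero_mul]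
  · rw [show (2 + 1 : Fin 4) = 3 from rfl, h.n3, mul_zero]
  · exact Or.inl ((congrArg (inner ℝ n) h.halfFold_u2).trans_ne h.n2)
  · rw [show (3 + 1 : Fin 4) = 0 from rfl, h.m0, mul_zero]
  · rw [h.n3, zero_mul]
  · exact Or.inr ((congrArg (inner ℝ n) h.halfFold_u0).trans_ne h.n0)

/-- The creases of `coneFold m n` are the rays along `u 0, …, u 3`. -/
theorem exists_ray (h : IsCone m n u) {z : ℂ} (hz : z ≠ 0)
    (hz' : inner ℝ m z = 0 ∨ inner ℝ n (halfFold m z) = 0) : ∃ i, ∃ t : ℝ, 0 < t ∧ z = t • u i := by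
  by_cases hm : inner ℝ m z = 0
  · obtain ⟨t, rfl⟩ := exists_smul_of_inner_eq_zero h.m_ne_zero (h.ne_zero 0) h.m0 hm
    obtain ⟨s, hs⟩ := exists_smul_of_inner_eq_zero h.m_ne_zero (h.ne_zero 0) h.m0 h.m2
    have h02 := h.n02
    rw [hs, real_inner_smul_right] at h02
    have hs0 : s < 0 := by
      by_contra! hs0
      nlinarith [mul_nonneg hs0 (mul_self_nonneg (inner ℝ n (u 0)))]
    have ht : t ≠ 0 := by rintro rfl; simp at hz
    rcases ht.lt_or_gt with ht | ht
    · refine ⟨2, t / s, div_pos_of_neg_of_neg ht hs0, ?_⟩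
      rw [hs, smul_smul, div_mul_cancel₀ _ hs0.ne]
    · exact ⟨0, t, ht, rfl⟩
  · have hn := hz'.resolve_left hm
    rcases lt_or_gt_of_ne hm with hm | hm
    · rw [halfFold_of_nonpos hm.le] at hn
      obtain ⟨t, rfl⟩ := exists_smul_of_inner_eq_zero h.n_ne_zero (h.ne_zero 1) h.n1 hn
      refine ⟨1, t, ?_, rfl⟩
      rw [real_inner_smul_right] at hm
      by_contra! ht
      nlinarith [h.m1]
    · have hz3 := h.n3
      rw [halfFold_of_nonneg h.norm_m hm.le] at hn
      rw [halfFold_of_nonneg h.norm_m h.m3.le] at hz3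
      obtain ⟨t, ht⟩ := exists_smul_of_inner_eq_zero h.n_ne_zero
        ((mirror m).map_eq_zero_iff.not.2 (h.ne_zero 3)) hz3 hn
      obtain rfl : z = t • u 3 := (mirror m).injective (by rw [ht, map_smul])
      refine ⟨3, t, ?_, rfl⟩
      rw [real_inner_smul_right] at hm
      by_contra! ht
      nlinarith [h.m3]

/-- Near the crease along `u i`, `coneFold m n` is a single fold. -/
theorem eventually_crease (h : IsCone m n u) : ∀ i, ∃ (B : ℂ ≃ₗᵢ[ℝ] ℂ) (k : ℂ), ‖k‖ = 1 ∧
    inner ℝ k (u i) = 0 ∧ inner ℝ k (u (i + 1)) < 0 ∧ 0 < inner ℝ k (u (i - 1)) ∧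
      ∀ᶠ z in 𝓝 (u i), coneFold m n z = B (halfFold k z) := by
  -- It suffices that the crease separates its two neighbours: replacing `k` by `-k`, at the price
  -- of a reflection in `B`, puts the next crease on the side that stays in place.
  have key : ∀ {z x y : ℂ}, (∃ (B : ℂ ≃ₗᵢ[ℝ] ℂ) (k : ℂ), ‖k‖ = 1 ∧ inner ℝ k z = 0 ∧
      inner ℝ k x * inner ℝ k y < 0 ∧ ∀ᶠ z in 𝓝 z, coneFold m n z = B (halfFold k z)) →
      ∃ (B : ℂ ≃ₗᵢ[ℝ] ℂ) (k : ℂ), ‖k‖ = 1 ∧ inner ℝ k z = 0 ∧ inner ℝ k x < 0 ∧ 0 < inner ℝ k y ∧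
        ∀ᶠ z in 𝓝 z, coneFold m n z = B (halfFold k z) := by
    rintro z x y ⟨B, k, hk, hkz, hkxy, hB⟩
    rcases mul_neg_iff.1 hkxy with ⟨h1, h2⟩ | ⟨h1, h2⟩
    · refine ⟨(mirror k).trans B, -k, by rwa [norm_neg], by rw [inner_neg_left, hkz, neg_zero],
        by rw [inner_neg_left]; linarith, by rw [inner_neg_left]; linarith, ?_⟩
      filter_upwards [hB] with w hw
      rw [hw, halfFold_neg hk, LinearIsometryEquiv.trans_apply, mirror_mirror]
    · exact ⟨B, k, hk, hkz, h1, h2, hB⟩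
  -- On the first folding line, off the second one: the second fold acts as an isometry there.
  have even : ∀ {z : ℂ}, inner ℝ m z = 0 → inner ℝ n z ≠ 0 → ∃ B : ℂ ≃ₗᵢ[ℝ] ℂ,
      ∀ᶠ w in 𝓝 z, coneFold m n w = B (halfFold m w) := by
    intro z hmz hnz
    obtain ⟨S, hS, -⟩ := halfFold_eventually h.norm_n hnz
    have hz : halfFold m z = z := halfFold_of_nonpos hmz.le
    have ht : Tendsto (halfFold m) (𝓝 z) (𝓝 z) := by
      have := (continuous_halfFold m).tendsto z
      rwa [hz] at this
    exact ⟨S, ht.eventually hS⟩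
  -- Off the first folding line the first fold is an isometry `R`, and the second line is pulled
  -- back through `R`.
  have odd : ∀ {z : ℂ}, inner ℝ m z ≠ 0 → inner ℝ n (halfFold m z) = 0 →
      ∃ (B : ℂ ≃ₗᵢ[ℝ] ℂ) (k : ℂ), ‖k‖ = 1 ∧ inner ℝ k z = 0 ∧
      inner ℝ k (u 0) * inner ℝ k (u 2) < 0 ∧
      ∀ᶠ w in 𝓝 z, coneFold m n w = B (halfFold k w) := by
    intro z hmz hnz
    obtain ⟨R, hR, hR'⟩ := halfFold_eventually h.norm_m hmz
    have hk : ∀ w, 0 ≤ inner ℝ m w * inner ℝ m z →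
        inner ℝ (R.symm n) w = inner ℝ n (halfFold m w) := by
      intro w hw
      rw [hR' w hw, ← R.inner_map_map, R.apply_symm_apply]
    refine ⟨R, R.symm n, by rw [R.symm.norm_map, h.norm_n],
      by rw [hk z (mul_self_nonneg _), hnz], ?_, ?_⟩
    · rw [hk _ (by rw [h.m0, zero_mul]), hk _ (by rw [h.m2, zero_mul]), h.halfFold_u0,
        h.halfFold_u2]
      exact h.n02
    · filter_upwards [hR] with w hw
      rw [coneFold, hw, halfFold_eq_map]
  refine Fin.forall_four ?_ ?_ ?_ ?_
  · obtain ⟨B, hB⟩ := even h.m0 h.n0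
    exact key ⟨B, m, h.norm_m, h.m0, mul_neg_of_neg_of_pos h.m1 h.m3, hB⟩
  · obtain ⟨B, k, h1, h2, h3, h4⟩ := odd h.m1.ne (by rw [h.halfFold_u1, h.n1])
    exact key ⟨B, k, h1, h2, mul_comm (inner ℝ k (u 0)) _ ▸ h3, h4⟩
  · obtain ⟨B, hB⟩ := even h.m2 h.n2
    exact key ⟨B, m, h.norm_m, h.m2, mul_neg_of_pos_of_neg h.m3 h.m1, hB⟩
  · obtain ⟨B, k, h1, h2, h3, h4⟩ := odd h.m3.ne' h.n3
    exact key ⟨B, k, h1, h2, h3, h4⟩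

/-- The image of `coneFold m n` lies in a wedge of opening angle less than `π`. -/
theorem exists_axis (h : IsCone m n u) : ∃ a : ℂ, ‖a‖ = 1 ∧ ∃ μ : ℝ, 0 < μ ∧
    ∀ z, μ * ‖z‖ ≤ inner ℝ a (coneFold m n z) := by
  -- The image satisfies `inner ℝ n · ≤ 0`, so `-n` is the main direction, and `-m` is added for the
  -- image vectors orthogonal to `n`. Reflection in the second line can change the `m`-component by
  -- up to twice the `n`-component; the weight 3 outweighs this.
  set a' : ℂ := -((3 : ℝ) • n + m) with ha'
  have hnn : inner ℝ n n = (1 : ℝ) := by rw [real_inner_self_eq_norm_sq, h.norm_n]; norm_num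
  have hnm : |inner ℝ m n| ≤ 1 := by
    have := abs_real_inner_le_norm m n
    rwa [h.norm_m, h.norm_n, one_mul] at this
  have hpos : ∀ z, z ≠ 0 → 0 < inner ℝ a' (coneFold m n z) := by
    intro z hz
    set y := halfFold m z with hy
    have hmy : inner ℝ m y ≤ 0 := inner_halfFold_nonpos h.norm_m z
    have hy0 : y ≠ 0 := by
      rw [← norm_ne_zero_iff, hy, norm_halfFold h.norm_m]
      exact norm_ne_zero_iff.2 hz
    have hval : ∀ w : ℂ, inner ℝ a' w = -(3 * inner ℝ n w + inner ℝ m w) := by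
      intro w
      rw [ha', inner_neg_left, inner_add_left, real_inner_smul_left]
    have hc : coneFold m n z = halfFold n y := rfl
    rcases lt_trichotomy (inner ℝ n y) 0 with hn | hn | hn
    · rw [hc, halfFold_of_nonpos hn.le, hval]
      linarith
    · obtain ⟨t, ht⟩ := exists_smul_of_inner_eq_zero h.n_ne_zero (h.ne_zero 1) h.n1 hn
      have hmy' : inner ℝ m y ≠ 0 := by
        rw [ht, real_inner_smul_right]
        refine mul_ne_zero ?_ h.m1.ne
        rintro rfl
        exact hy0 (by rw [ht, zero_smul])
      rw [hc, halfFold_of_nonpos hn.le, hval, hn]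
      have := lt_of_le_of_ne hmy hmy'
      linarith
    · rw [hc, halfFold_of_nonneg h.norm_n hn.le, hval, inner_mirror h.norm_n,
        mirror_apply h.norm_n, inner_sub_right, real_inner_smul_right]
      nlinarith [abs_le.1 hnm]
  have ha0 : a' ≠ 0 := by
    intro h0
    have := hpos (u 0) (h.ne_zero 0)
    rw [h0, inner_zero_left] at this
    exact this.false
  have hna : 0 < ‖a'‖ := norm_pos_iff.2 ha0
  have hcont : Continuous fun z => inner ℝ (‖a'‖⁻¹ • a') (coneFold m n z) := by fun_prop
  -- Pointwise positivity becomes a uniform bound: the minimum over the unit circle serves as `μ`,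
  -- and homogeneity extends it to the plane.
  obtain ⟨z₀, hz₀, hmin⟩ := (isCompact_sphere (0 : ℂ) 1).exists_isMinOn
    (NormedSpace.sphere_nonempty.2 zero_le_one) hcont.continuousOn
  refine ⟨‖a'‖⁻¹ • a', by rw [norm_smul, norm_inv, norm_norm, inv_mul_cancel₀ hna.ne'],
    inner ℝ (‖a'‖⁻¹ • a') (coneFold m n z₀), ?_, fun z => ?_⟩
  · rw [real_inner_smul_left]
    refine mul_pos (inv_pos.2 hna) (hpos _ ?_)
    rw [mem_sphere_zero_iff_norm] at hz₀
    exact norm_ne_zero_iff.1 (by rw [hz₀]; norm_num)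
  · rcases eq_or_ne z 0 with rfl | hz
    · simp only [norm_zero, mul_zero, coneFold_zero, inner_zero_right, le_refl]
    · have hz' : 0 < ‖z‖ := norm_pos_iff.2 hz
      have h1 := hmin (show ‖z‖⁻¹ • z ∈ Metric.sphere (0 : ℂ) 1 by
        rw [mem_sphere_zero_iff_norm, norm_smul, norm_inv, norm_norm, inv_mul_cancel₀ hz'.ne'])
      have h2 : coneFold m n z = ‖z‖ • coneFold m n (‖z‖⁻¹ • z) := by
        rw [← coneFold_smul _ _ _ hz'.le, smul_smul, mul_inv_cancel₀ hz'.ne', one_smul]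
      rw [h2, real_inner_smul_right, mul_comm]
      exact mul_le_mul_of_nonneg_left h1 hz'.le

theorem norm_coneFold (h : IsCone m n u) (z : ℂ) : ‖coneFold m n z‖ = ‖z‖ := by
  rw [coneFold, norm_halfFold h.norm_n, norm_halfFold h.norm_m]

end IsCone

/-! ## Edges of the graph of a folding -/

/-- `cross x y` is the determinant of the vectors `x` and `y`. -/
def cross (x y : ℂ) : ℝ := x.re * y.im - x.im * y.re

theorem IsCreasePoint.not_isVertexPoint {φ : ℂ → ℂ} {p : ℂ} (h : IsCreasePoint φ p) :
    ¬ IsVertexPoint φ p := fun h' => h'.2.1 h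

namespace FoldVertex

variable {φ : ℂ → ℂ}

/-- A centre for the neighbourhoods of a vertex. -/
def center : FoldVertex φ → ℂ
  | point p _ => p
  | infinity _ => 0

/-- The sign that relates directions of travel to directions away from the centre. -/
def sgn : FoldVertex φ → ℝ
  | point _ _ => 1
  | infinity _ => -1

theorem sgn_eq_or (a : FoldVertex φ) : a.sgn = 1 ∨ a.sgn = -1 := by
  cases a <;> simp [sgn]

end FoldVertex

/-- There is an edge from `a` to `b` that leaves `a` in the direction of `z`. Edges to infinity are
required to point away from the origin. -/
def Link (φ : ℂ → ℂ) : FoldVertex φ → FoldVertex φ → ℂ → Prop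
  | .point p _, .point q _, z => z = q - p ∧ ∀ x ∈ openSegment ℝ p q, IsCreasePoint φ x
  | .point p _, .infinity _, z => IsCreaseRay φ p z ∧ ∃ t : ℝ, 0 ≤ t ∧ p = t • z
  | .infinity _, .point p _, z => IsCreaseRay φ p (-z) ∧ ∃ t : ℝ, 0 ≤ t ∧ p = t • (-z)
  | .infinity _, .infinity _, _ => False

namespace Link

variable {φ : ℂ → ℂ}

theorem symm : ∀ {a b : FoldVertex φ} {z : ℂ}, Link φ a b z → Link φ b a (-z)
  | .point p _, .point q _, z, ⟨h1, h2⟩ =>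
    ⟨by rw [h1, neg_sub], fun x hx => h2 x (openSegment_symm ℝ p q ▸ hx)⟩
  | .point p _, .infinity _, z, h => by simpa [Link] using h
  | .infinity _, .point p _, z, h => h

theorem ne_zero {a b : FoldVertex φ} {z : ℂ} (h : Link φ a b z) : z ≠ 0 := by
  rcases a with ⟨p, hp⟩ | _ <;> rcases b with ⟨q, hq⟩ | _
  · rintro rfl
    obtain rfl : p = q := by simpa [sub_eq_zero, eq_comm] using h.1
    exact (h.2 p (by simp)).not_isVertexPoint hp
  · exact norm_ne_zero_iff.1 (by rw [h.1.1]; norm_num)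
  · exact norm_ne_zero_iff.1 (by rw [← norm_neg, h.1.1]; norm_num)
  · exact h.elim

theorem ne {a b : FoldVertex φ} {z : ℂ} (h : Link φ a b z) : a ≠ b := by
  rintro rfl
  rcases a with ⟨p, hp⟩ | _
  · exact h.ne_zero (by simpa using h.1)
  · exact h

end Link

namespace FoldDart

variable {φ : ℂ → ℂ}

/-- The direction of travel. -/
def dir : FoldDart φ → ℂ
  | segment p q _ _ _ => q - p
  | ray _ u _ _ => u
  | rayRev _ u _ _ => -u

/-- The dart that is described by a link. -/
def ofLink : (a b : FoldVertex φ) → (z : ℂ) → Link φ a b z → FoldDart φ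
  | .point p hp, .point q hq, _, h => segment p q hp hq h.2
  | .point p hp, .infinity _, z, h => ray p z hp h.1
  | .infinity _, .point p hp, z, h => rayRev p (-z) hp h.1

theorem tail_ofLink : ∀ {a b : FoldVertex φ} {z : ℂ} (h : Link φ a b z), (ofLink a b z h).tail = a
  | .point _ _, .point _ _, _, _ => rfl
  | .point _ _, .infinity _, _, _ => rfl
  | .infinity _, .point _ _, _, _ => rfl

theorem dir_ofLink : ∀ {a b : FoldVertex φ} {z : ℂ} (h : Link φ a b z), (ofLink a b z h).dir = z
  | .point _ _, .point _ _, _, h => h.1.symm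
  | .point _ _, .infinity _, _, _ => rfl
  | .infinity _, .point _ _, z, _ => neg_neg z

theorem rev_ofLink : ∀ {a b : FoldVertex φ} {z : ℂ} (h : Link φ a b z),
    (ofLink a b z h).rev = ofLink b a (-z) h.symm
  | .point _ _, .point _ _, _, _ => rfl
  | .point p hp, .infinity _, z, h => by
    simp only [ofLink, rev, neg_neg]
  | .infinity _, .point _ _, _, _ => rfl

theorem ofLink_congr {a b a' b' : FoldVertex φ} {z z' : ℂ} (h : Link φ a b z) (ha : a = a')
    (hb : b = b') (hz : z = z') : ofLink a b z h = ofLink a' b' z' (ha ▸ hb ▸ hz ▸ h) := by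
  subst ha hb hz
  rfl

theorem rev_rev (D : FoldDart φ) : D.rev.rev = D := by
  cases D <;> rfl

/-- Since linked rays lie on lines through the origin, their signed offsets vanish, and the order
around ∞ is decided by angles alone. -/
theorem slot_ofLink : ∀ {a b : FoldVertex φ} {z : ℂ} (h : Link φ a b z),
    (ofLink a b z h).slot = toLex (a.sgn * Complex.arg (a.sgn • z), (0 : ℝ))
  | .point p _, .point q _, z, h => by simp [ofLink, slot, FoldVertex.sgn, h.1]
  | .point p _, .infinity _, z, h => by simp [ofLink, slot, FoldVertex.sgn]
  | .infinity _, .point p _, z, h => by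
    obtain ⟨t, -, ht⟩ := h.2
    have : ((starRingEnd ℂ) (-z) * p).im = 0 := by
      rw [ht]
      simp [Complex.mul_im]
      ring
    simp only [ofLink, slot, FoldVertex.sgn]
    rw [this]
    simp

/-- Two edges that leave a point in the same direction are equal. -/
theorem eq_of_dir {p : ℂ} {hp : IsVertexPoint φ p} : ∀ {D E : FoldDart φ} {r : ℝ}, 0 < r →
    D.tail = .point p hp → E.tail = .point p hp → D.dir = r • E.dir → D = E := by
  -- If two edges in one direction had different lengths, the end of the shorter one would be a
  -- vertex point inside the longer one, which consists of crease points.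
  have seg : ∀ {q q' : ℂ} {r : ℝ}, 0 < r → r < 1 → IsVertexPoint φ q →
      (∀ x ∈ openSegment ℝ p q', IsCreasePoint φ x) → q - p = r • (q' - p) → False := by
    intro q q' r hr hr1 hq h e
    refine (h q ?_).not_isVertexPoint hq
    rw [openSegment_eq_image']
    exact ⟨r, ⟨hr, hr1⟩, by simp only; rw [← e]; ring⟩
  have seg_ray : ∀ {q u : ℂ} {r : ℝ}, 0 < r → IsVertexPoint φ q → IsCreaseRay φ p u →
      q - p = r • u → False := by
    intro q u r hr hq h e
    refine (h.2 r hr).not_isVertexPoint (p := p + r * u) ?_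
    rwa [← Complex.real_smul, ← e, add_sub_cancel]
  intro D E r hr hD hE h
  cases D with
  | segment p₁ q h1 h2 h3 =>
    obtain rfl : p₁ = p := by simpa [tail] using hD
    cases E with
    | segment p₂ q' h1' h2' h3' =>
      obtain rfl : p₂ = p₁ := by simpa [tail] using hE
      have h : q - p₂ = r • (q' - p₂) := h
      rcases lt_trichotomy r 1 with hr1 | rfl | hr1
      · exact (seg hr hr1 h2 h3' h).elim
      · obtain rfl : q = q' := by simpa using h
        rfl
      · refine (seg (inv_pos.2 hr) (inv_lt_one_of_one_lt₀ hr1) h2' h3 ?_).elim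
        rw [h, smul_smul, inv_mul_cancel₀ hr.ne', one_smul]
    | ray p₂ u h1' h2' =>
      obtain rfl : p₂ = p₁ := by simpa [tail] using hE
      exact (seg_ray hr h2 h2' h).elim
    | rayRev p₂ u h1' h2' => simp [tail] at hE
  | ray p₁ u h1 h2 =>
    obtain rfl : p₁ = p := by simpa [tail] using hD
    cases E with
    | segment p₂ q' h1' h2' h3' =>
      obtain rfl : p₂ = p₁ := by simpa [tail] using hE
      have h : u = r • (q' - p₂) := h
      refine (seg_ray (inv_pos.2 hr) h2' h2 ?_).elim
      rw [h, smul_smul, inv_mul_cancel₀ hr.ne', one_smul]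
    | ray p₂ u' h1' h2' =>
      obtain rfl : p₂ = p₁ := by simpa [tail] using hE
      have h : u = r • u' := h
      have hn := congrArg norm h
      rw [norm_smul, h2.1, h2'.1, Real.norm_of_nonneg hr.le, mul_one] at hn
      obtain rfl : u = u' := by rw [h, ← hn, one_smul]
      rfl
    | rayRev p₂ u h1' h2' => simp [tail] at hE
  | rayRev p₁ u h1 h2 => simp [tail] at hD

/-- Points of a dart close to its starting point are crease points. -/
theorem eventually_isCreasePoint {p : ℂ} {hp : IsVertexPoint φ p} {D : FoldDart φ}
    (hD : D.tail = .point p hp) : ∀ᶠ t : ℝ in 𝓝[>] 0, IsCreasePoint φ (p + t • D.dir) := by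
  cases D with
  | segment p₁ q h1 h2 h3 =>
    obtain rfl : p₁ = p := by simpa [tail] using hD
    filter_upwards [Ioo_mem_nhdsGT (zero_lt_one' ℝ)] with t ht
    refine h3 _ ?_
    rw [openSegment_eq_image']
    exact ⟨t, ht, rfl⟩
  | ray p₁ u h1 h2 =>
    obtain rfl : p₁ = p := by simpa [tail] using hD
    filter_upwards [self_mem_nhdsWithin] with t ht
    simpa [dir] using h2.2 t ht
  | rayRev p₁ u h1 h2 => simp [tail] at hD

theorem dir_ne_zero {p : ℂ} {hp : IsVertexPoint φ p} {D : FoldDart φ}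
    (hD : D.tail = .point p hp) : D.dir ≠ 0 := by
  intro h0
  obtain ⟨t, ht⟩ := (eventually_isCreasePoint hD).exists
  rw [h0, smul_zero, add_zero] at ht
  exact ht.not_isVertexPoint hp

end FoldDart

/-! ## Cyclic order -/

/-- The sine of the difference of arguments does not see the branch cut, so the sign of a
determinant can be transferred to angles. -/
theorem sin_arg_sub_arg {x y : ℂ} (hx : x ≠ 0) (hy : y ≠ 0) :
    Real.sin (y.arg - x.arg) = cross x y / (‖x‖ * ‖y‖) := by
  have h1 : ‖x‖ ≠ 0 := norm_ne_zero_iff.2 hx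
  have h2 : ‖y‖ ≠ 0 := norm_ne_zero_iff.2 hy
  rw [Real.sin_sub, Complex.sin_arg, Complex.sin_arg, Complex.cos_arg hx, Complex.cos_arg hy, cross]
  field_simp

theorem lt_or_lt_of_sin_pos {x : ℝ} (h : 0 < Real.sin x) (h1 : x < 2 * Real.pi) : 0 < x ∧ x < Real.pi ∨ x < -Real.pi := by
  have := Real.pi_pos
  by_contra! hx
  rcases le_or_gt x 0 with h0 | h0
  · exact absurd (Real.sin_nonpos_of_nonpos_of_neg_pi_le h0 (hx.2)) (not_le.2 h)
  · have h3 := hx.1 h0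
    have h4 : Real.sin (x - Real.pi) < 0 ∨ Real.sin (x - Real.pi) ≥ 0 := lt_or_ge _ _
    have h5 : 0 ≤ Real.sin (x - Real.pi) :=
      Real.sin_nonneg_of_nonneg_of_le_pi (by linarith) (by linarith)
    rw [Real.sin_sub_pi] at h5
    linarith

/-- Each step of the angle is either in `(0, π)` or less than `-π`. The four steps sum to zero, so
exactly one of them is negative: none would give a positive sum, two or more a negative one. Thus
the angles increase in index order, apart from one wrap-around. -/
theorem isCyclicSucc_of_sin_pos {β : Fin 4 → ℝ} (h : ∀ i, 0 < Real.sin (β (i + 1) - β i))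
    (h1 : ∀ i, β (i + 1) - β i < 2 * Real.pi) (i : Fin 4) :
    IsCyclicSucc (range fun i => toLex (β i, (0 : ℝ))) (toLex (β i, 0)) (toLex (β (i + 1), 0)) := by
  have hlt : ∀ a b : ℝ, toLex (a, (0 : ℝ)) < toLex (b, (0 : ℝ)) ↔ a < b := by
    intro a b
    simp [Prod.Lex.toLex_lt_toLex]
  have hle : ∀ a b : ℝ, toLex (a, (0 : ℝ)) ≤ toLex (b, (0 : ℝ)) ↔ a ≤ b := by
    intro a b
    rw [← not_lt, hlt, not_lt]
  refine ⟨⟨i, rfl⟩, ⟨i + 1, rfl⟩, ?_⟩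
  have hpi := Real.pi_pos
  have k := fun i => lt_or_lt_of_sin_pos (h i) (h1 i)
  have k0 := k 0
  have k1 := k 1
  have k2 := k 2
  have k3 := k 3
  rw [show (0 + 1 : Fin 4) = 1 from rfl] at k0
  rw [show (1 + 1 : Fin 4) = 2 from rfl] at k1
  rw [show (2 + 1 : Fin 4) = 3 from rfl] at k2
  rw [show (3 + 1 : Fin 4) = 0 from rfl] at k3
  simp only [IsGreatest, IsLeast, upperBounds, lowerBounds, mem_range, exists_apply_eq_apply,
    true_and, forall_exists_index, forall_apply_eq_imp_iff, hlt, hle, mem_ofPred_eq]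
  rcases lt_or_ge (β i) (β (i + 1)) with hi | hi
  · left
    refine ⟨hi, ?_⟩
    revert i
    refine Fin.forall_four ?_ ?_ ?_ ?_ <;> intro hi <;> refine Fin.forall_four ?_ ?_ ?_ ?_ <;>
      rintro ⟨h3, h4⟩ <;> simp only [Fin.reduceAdd, Fin.isValue, zero_add] at hi h3 h4 <;>
      rcases k0 with k0 | k0 <;> rcases k1 with k1 | k1 <;> rcases k2 with k2 | k2 <;>
      rcases k3 with k3 | k3 <;> linarith
  · right
    revert i
    refine Fin.forall_four ?_ ?_ ?_ ?_ <;> intro hi <;> constructor <;>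
      refine Fin.forall_four ?_ ?_ ?_ ?_ <;>
      simp only [Fin.reduceAdd, Fin.isValue, zero_add] at hi ⊢ <;>
      rcases k0 with k0 | k0 <;> rcases k1 with k1 | k1 <;> rcases k2 with k2 | k2 <;>
      rcases k3 with k3 | k3 <;> linarith

theorem cross_neg_neg (x y : ℂ) : cross (-x) (-y) = cross x y := by
  simp [cross]

theorem cross_smul_smul (s t : ℝ) (x y : ℂ) : cross (s • x) (t • y) = s * t * cross x y := by
  simp [cross]
  ring

theorem isCyclicSucc_arg {σ : ℝ} (hσ : σ = 1 ∨ σ = -1) {u : Fin 4 → ℂ} (hu : ∀ i, u i ≠ 0)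
    (h : ∀ i, 0 < σ * cross (u i) (u (i + 1))) (i : Fin 4) :
    IsCyclicSucc (range fun i => toLex (σ * (u i).arg, (0 : ℝ))) (toLex (σ * (u i).arg, 0))
      (toLex (σ * (u (i + 1)).arg, 0)) := by
  refine isCyclicSucc_of_sin_pos (β := fun i => σ * (u i).arg) (fun i => ?_) (fun i => ?_) i
  · have h1 := sin_arg_sub_arg (hu i) (hu (i + 1))
    have h2 : 0 < ‖u i‖ * ‖u (i + 1)‖ :=
      mul_pos (norm_pos_iff.2 (hu i)) (norm_pos_iff.2 (hu (i + 1)))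
    have h3 : Real.sin (σ * (u (i + 1)).arg - σ * (u i).arg) =
        σ * cross (u i) (u (i + 1)) / (‖u i‖ * ‖u (i + 1)‖) := by
      rcases hσ with rfl | rfl
      · simpa using h1
      · rw [← mul_sub, neg_one_mul, Real.sin_neg, h1]
        ring
    simp only [h3]
    exact div_pos (h i) h2
  · have h1 := Complex.arg_le_pi (u i)
    have h2 := Complex.arg_le_pi (u (i + 1))
    have h3 := Complex.neg_pi_lt_arg (u i)
    have h4 := Complex.neg_pi_lt_arg (u (i + 1))
    rcases hσ with rfl | rfl <;> linarith

/-! ## Foldings whose graph is known -/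

/-- Near the vertex `y` of the graph `G`, the folding `φ` is a cone with four sectors, and the darts
of `G` at `y` follow the creases in cyclic order. -/
structure ConeAt (G : RotationSystem) (φ : ℂ → ℂ) (dir : G.D → ℂ) (y : G.V) (a : FoldVertex φ)
    (w : Fin 4 → G.D) (m n b : ℂ) (L : ℂ ≃ₗᵢ[ℝ] ℂ) : Prop where
  tail : ∀ i, G.tail (w i) = y
  rot : ∀ i, G.rot (w i) = w (i + 1)
  isCone : IsCone m n fun i => a.sgn • dir (w i)
  orient : ∀ i, 0 < a.sgn * cross (dir (w i)) (dir (w (i + 1)))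
  germ : ∀ᶠ x in a.nhds, φ x = b + L (coneFold m n (x - a.center))

/-- A description of the graph of the folding `φ` by the rotation system `G`, together with the
shape of `φ` near the vertices. -/
structure FoldModel (G : RotationSystem) (φ : ℂ → ℂ) where
  cont : Continuous φ
  cases_point : ∀ p, IsUnfoldedPoint φ p ∨ IsCreasePoint φ p ∨ IsVertexPoint φ p
  exists_ray : ∃ p u, IsCreaseRay φ p u
  onV : G.V ≃ FoldVertex φ
  dir : G.D → ℂ
  dir_rev : ∀ d, dir (G.rev d) = -dir d
  link : ∀ d, Link φ (onV (G.tail d)) (onV (G.tail (G.rev d))) (dir d)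
  cone : ∀ y, ∃ w m n b L, ConeAt G φ dir y (onV y) w m n b L

namespace ConeAt

variable {G : RotationSystem} {φ : ℂ → ℂ} {dir : G.D → ℂ} {y : G.V} {a : FoldVertex φ}
  {w : Fin 4 → G.D} {m n b : ℂ} {L : ℂ ≃ₗᵢ[ℝ] ℂ}

/-- The four listed darts are closed under rotation, and the darts at a vertex form a single
rotation orbit. -/
theorem exists_eq (h : ConeAt G φ dir y a w m n b L) {d : G.D} (hd : G.tail d = y) :
    ∃ i, d = w i := by
  have := G.finite_D
  obtain ⟨k, hk⟩ := (G.sameCycle (w 0) d ((h.tail 0).trans hd.symm)).exists_nat_pow_eq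
  have : ∀ k : ℕ, ∃ i, (G.rot ^ k) (w 0) = w i := by
    intro k
    induction k with
    | zero => exact ⟨0, rfl⟩
    | succ k ih =>
      obtain ⟨i, hi⟩ := ih
      exact ⟨i + 1, by rw [pow_succ', Equiv.Perm.mul_apply, hi, h.rot]⟩
  obtain ⟨i, hi⟩ := this k
  exact ⟨i, hk.symm.trans hi⟩

end ConeAt

/-- Different creases of a cone have different directions. -/
theorem IsCone.index_eq {m n : ℂ} {u : Fin 4 → ℂ} (h : IsCone m n u) :
    ∀ i j, ∀ t : ℝ, 0 < t → u i = t • u j → i = j := by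
  have key : ∀ {k : ℂ} {i j : Fin 4} {t : ℝ}, 0 < t → u i = t • u j →
      inner ℝ k (u i) = t * inner ℝ k (u j) := by
    intro k i j t ht e
    rw [e, real_inner_smul_right]
  have m0 := h.m0
  have m1 := h.m1
  have m2 := h.m2
  have m3 := h.m3
  have n02 := h.n02
  refine Fin.forall_four ?_ ?_ ?_ ?_ <;> refine Fin.forall_four ?_ ?_ ?_ ?_ <;> intro t ht e <;>
    first
    | rfl
    | exfalso
      have e1 := key (k := m) ht e
      have e2 := key (k := n) ht e
      first
      | (rw [e2] at n02; nlinarith [mul_self_nonneg (inner ℝ n (u 0)),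
          mul_self_nonneg (inner ℝ n (u 2))])
      | nlinarith

namespace FoldModel

variable {G : RotationSystem} {φ : ℂ → ℂ} (M : FoldModel G φ)

/-- The dart of the folding that is described by a dart of `G`. -/
def dart (d : G.D) : FoldDart φ := FoldDart.ofLink _ _ _ (M.link d)

theorem tail_dart (d : G.D) : (M.dart d).tail = M.onV (G.tail d) := FoldDart.tail_ofLink _

theorem dir_dart (d : G.D) : (M.dart d).dir = M.dir d := FoldDart.dir_ofLink _

theorem rev_dart (d : G.D) : (M.dart d).rev = M.dart (G.rev d) := by
  rw [dart, FoldDart.rev_ofLink]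
  exact FoldDart.ofLink_congr _ rfl (by rw [G.rev_rev]) (M.dir_rev d).symm

theorem slot_dart (d : G.D) : (M.dart d).slot =
    toLex ((M.onV (G.tail d)).sgn * Complex.arg ((M.onV (G.tail d)).sgn • M.dir d), (0 : ℝ)) :=
  FoldDart.slot_ofLink _

theorem dart_injective : Function.Injective M.dart := by
  intro d e h
  have ht : G.tail d = G.tail e := by
    have := congrArg FoldDart.tail h
    rwa [tail_dart, tail_dart, M.onV.apply_eq_iff_eq] at this
  have hd := congrArg FoldDart.dir h
  rw [dir_dart, dir_dart] at hd
  obtain ⟨w, m, n, b, L, hc⟩ := M.cone (G.tail e)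
  obtain ⟨i, rfl⟩ := hc.exists_eq ht
  obtain ⟨j, hj⟩ := hc.exists_eq (rfl : G.tail e = G.tail e)
  rw [hj] at hd ⊢
  rw [hc.isCone.index_eq i j 1 one_pos (by simp only [hd, one_smul])]

/-- Near a vertex point all crease points lie on the four crease rays of the cone, so the graph of
the folding cannot have an edge in another direction. Darts starting at ∞ are reached by reversal.
-/
theorem dart_surjective : Function.Surjective M.dart := by
  have key : ∀ (D : FoldDart φ) (p : ℂ) (hp : IsVertexPoint φ p), D.tail = .point p hp →
      ∃ d, M.dart d = D := by
    intro D p hp hD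
    obtain ⟨y, hy⟩ := M.onV.surjective (.point p hp)
    obtain ⟨w, m, n, b, L, hc⟩ := M.cone y
    have hcone := hc.isCone
    have hgerm := hc.germ
    rw [hy] at hcone hgerm
    simp only [FoldVertex.sgn, one_smul] at hcone
    simp only [FoldVertex.nhds, FoldVertex.center] at hgerm
    -- Otherwise the folding agrees with an isometry around points of the dart close to `p`, which
    -- would then be unfolded.
    have hz : inner ℝ m D.dir = 0 ∨ inner ℝ n (halfFold m D.dir) = 0 := by
      by_contra! hz
      obtain ⟨t, ⟨ht1, ht2⟩, ht⟩ := (((FoldDart.eventually_isCreasePoint hD).and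
        (eventually_smul_add (eventually_eventually_nhds.2 hgerm) D.dir)).and
        self_mem_nhdsWithin).exists
      have ht : 0 < t := ht
      refine ht1.1 ?_
      obtain ⟨B, hB⟩ := coneFold_eventually (z := t • D.dir) hcone.norm_m hcone.norm_n
        (by rw [real_inner_smul_right]; exact mul_ne_zero ht.ne' hz.1)
        (by rw [halfFold_smul _ _ ht.le, real_inner_smul_right]; exact mul_ne_zero ht.ne' hz.2)
      have hB' : ∀ᶠ x in 𝓝 (p + t • D.dir), coneFold m n (x - p) = B (x - p) := by
        refine Tendsto.eventually (f := fun x => x - p) ?_ hB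
        have : Tendsto (fun x => x - p) (𝓝 (p + t • D.dir)) (𝓝 (p + t • D.dir - p)) :=
          (continuous_id.sub continuous_const).tendsto _
        rwa [add_sub_cancel_left] at this
      refine isUnfoldedPoint_of_eventually (b := b + L (B (t • D.dir))) (L := B.trans L) ?_
      filter_upwards [ht2, hB'] with x h1 h2
      rw [h1, h2, LinearIsometryEquiv.trans_apply, add_assoc, ← map_add, ← map_add]
      congr 3
      ring
    obtain ⟨i, t, ht, hi⟩ := hcone.exists_ray (FoldDart.dir_ne_zero hD) hz
    refine ⟨w i, (FoldDart.eq_of_dir ht hD ?_ ?_).symm⟩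
    · rw [tail_dart, hc.tail, hy]
    · rw [dir_dart, hi]
  intro D
  cases D with
  | segment p q hp hq h => exact key _ p hp rfl
  | ray p u hp h => exact key _ p hp rfl
  | rayRev p u hp h =>
    obtain ⟨d, hd⟩ := key (.ray p u hp h) p hp rfl
    exact ⟨G.rev d, by rw [← rev_dart, hd]; rfl⟩

/-- The isomorphism from `G` to the graph of `φ`. -/
noncomputable def realization : FoldRealization G φ where
  onV := M.onV
  onD := Equiv.ofBijective M.dart ⟨M.dart_injective, M.dart_surjective⟩
  tail_onD := M.tail_dart
  rev_onD := M.rev_dart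
  next_onD := by
    intro d
    obtain ⟨w, m, n, b, L, hc⟩ := M.cone (G.tail d)
    obtain ⟨i, hi⟩ := hc.exists_eq (rfl : G.tail d = G.tail d)
    have hset : {x : FoldDart φ | x.tail = (M.dart d).tail} = range fun i => M.dart (w i) := by
      ext x
      obtain ⟨e, rfl⟩ := M.dart_surjective x
      rw [mem_ofPred_eq, tail_dart, tail_dart, M.onV.apply_eq_iff_eq]
      refine ⟨fun he => ?_, ?_⟩
      · obtain ⟨j, rfl⟩ := hc.exists_eq he
        exact ⟨j, rfl⟩
      · rintro ⟨j, hj⟩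
        rw [← M.dart_injective hj, hc.tail]
    change FoldDart.IsNext (M.dart d) (M.dart (G.rot d))
    refine ⟨by rw [tail_dart, tail_dart, G.tail_rot], ?_⟩
    rw [hset, ← range_comp]
    have hslot : ∀ j, (M.dart (w j)).slot = toLex ((M.onV (G.tail d)).sgn *
        Complex.arg ((M.onV (G.tail d)).sgn • M.dir (w j)), (0 : ℝ)) := by
      intro j
      rw [slot_dart, hc.tail]
    have h1 : (M.dart d).slot = _ := (congrArg (fun e => (M.dart e).slot) hi).trans (hslot i)
    have h2 : (M.dart (G.rot d)).slot = _ :=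
      (congrArg (fun e => (M.dart (G.rot e)).slot) hi).trans
        ((congrArg (fun e => (M.dart e).slot) (hc.rot i)).trans (hslot (i + 1)))
    rw [h1, h2, show (FoldDart.slot ∘ fun i => M.dart (w i)) = _ from funext hslot]
    refine isCyclicSucc_arg (u := fun j => (M.onV (G.tail d)).sgn • M.dir (w j))
      (FoldVertex.sgn_eq_or _) hc.isCone.ne_zero (fun j => ?_) i
    have h3 := hc.orient j
    rcases FoldVertex.sgn_eq_or (M.onV (G.tail d)) with h | h <;> rw [h] at h3 ⊢ <;>
      simpa [cross_neg_neg] using h3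

end FoldModel

/-! ## The points of an edge -/

namespace Link

variable {φ ψ : ℂ → ℂ}

/-- The interior points of the edge from `a` to `b` in the direction of `z`. -/
def path : FoldVertex φ → FoldVertex φ → ℂ → Set ℂ
  | .point p _, .point q _, _ => openSegment ℝ p q
  | .point p _, .infinity _, z => {x | ∃ t : ℝ, 0 < t ∧ x = p + t • z}
  | .infinity _, .point p _, z => {x | ∃ t : ℝ, 0 < t ∧ x = p + t • (-z)}
  | .infinity _, .infinity _, _ => ∅

theorem path_symm : ∀ (a b : FoldVertex φ) (z : ℂ), path b a (-z) = path a b z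
  | .point p _, .point q _, _ => openSegment_symm ℝ q p
  | .point p _, .infinity _, z => by simp [path]
  | .infinity _, .point p _, z => rfl
  | .infinity _, .infinity _, _ => rfl

theorem isCreasePoint {a b : FoldVertex φ} {z x : ℂ} (h : Link φ a b z) (hx : x ∈ path a b z) :
    IsCreasePoint φ x := by
  rcases a with ⟨p, hp⟩ | _ <;> rcases b with ⟨q, hq⟩ | _
  · exact h.2 x hx
  · obtain ⟨t, ht, rfl⟩ := hx
    exact h.1.2 t ht
  · obtain ⟨t, ht, rfl⟩ := hx
    exact h.1.2 t ht
  · exact hx.elim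

/-- For an edge at ∞ the centre is the origin. The claim then depends on the requirement that rays
point away from the origin along lines through it. -/
theorem exists_eq_of_mem_path {a b : FoldVertex φ} {z x : ℂ} (h : Link φ a b z)
    (hx : x ∈ path a b z) : ∃ t : ℝ, 0 < t ∧ x = a.center + t • (a.sgn • z) := by
  rcases a with ⟨p, hp⟩ | _ <;> rcases b with ⟨q, hq⟩ | _
  · rw [path, openSegment_eq_image'] at hx
    obtain ⟨t, ht, rfl⟩ := hx
    exact ⟨t, ht.1, by simp [FoldVertex.center, FoldVertex.sgn, h.1]⟩
  · obtain ⟨t, ht, rfl⟩ := hx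
    exact ⟨t, ht, by simp [FoldVertex.center, FoldVertex.sgn]⟩
  · obtain ⟨t, ht, rfl⟩ := hx
    obtain ⟨s, hs, hq'⟩ := h.2
    refine ⟨s + t, by linarith, ?_⟩
    rw [FoldVertex.center, FoldVertex.sgn, neg_one_smul, zero_add, add_smul, ← hq']
  · exact hx.elim

theorem eventually_mem_path {a b : FoldVertex φ} {z : ℂ} (h : Link φ a b z) :
    ∀ᶠ x in a.nhds, ∀ t : ℝ, 0 < t → x = a.center + t • (a.sgn • z) → x ∈ path a b z := by
  have hz := norm_pos_iff.2 h.ne_zero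
  rcases a with ⟨p, hp⟩ | _ <;> rcases b with ⟨q, hq⟩ | _
  · filter_upwards [Metric.ball_mem_nhds p hz] with x hx t ht hxt
    simp only [FoldVertex.center, FoldVertex.sgn, one_smul] at hxt
    rw [path, openSegment_eq_image']
    refine ⟨t, ⟨ht, ?_⟩, by simp only [hxt, h.1]⟩
    rw [Metric.mem_ball, dist_eq_norm, hxt, add_sub_cancel_left, norm_smul,
      Real.norm_of_nonneg ht.le] at hx
    by_contra! h1
    nlinarith
  · refine Eventually.of_forall fun x t ht hxt => ⟨t, ht, ?_⟩
    simpa [FoldVertex.center, FoldVertex.sgn] using hxt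
  -- The ray begins at distance `s` from the origin, so only points beyond that radius are
  -- guaranteed to belong to the edge.
  · obtain ⟨s, hs, hq'⟩ := h.2
    filter_upwards [tendsto_norm_cocompact_atTop.eventually_gt_atTop s] with x hx t ht hxt
    simp only [FoldVertex.center, FoldVertex.sgn, neg_one_smul, zero_add] at hxt
    have hu : ‖-z‖ = 1 := h.1.1
    rw [hxt, norm_smul, hu, Real.norm_of_nonneg ht.le, mul_one] at hx
    refine ⟨t - s, by linarith, ?_⟩
    rw [hxt, sub_smul, ← hq']
    ring
  · exact h.elim

theorem isClosed_ray {p u : ℂ} (hu : ‖u‖ = 1) : IsClosed {x | ∃ t : ℝ, 0 ≤ t ∧ x = p + t • u} := by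
  have : {x | ∃ t : ℝ, 0 ≤ t ∧ x = p + t • u} =
      {x | x - p = (inner ℝ u (x - p) : ℝ) • u ∧ 0 ≤ (inner ℝ u (x - p) : ℝ)} := by
    ext x
    constructor
    · rintro ⟨t, ht, rfl⟩
      have h1 : inner ℝ u (p + t • u - p) = t := by
        rw [add_sub_cancel_left, real_inner_smul_right, real_inner_self_eq_norm_sq, hu]
        ring
      refine ⟨?_, ?_⟩
      · rw [h1, add_sub_cancel_left]
      · rwa [h1]
    · rintro ⟨h1, h2⟩
      exact ⟨_, h2, by rw [← h1]; ring⟩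
  rw [this]
  have hc : Continuous fun x : ℂ => (inner ℝ u (x - p) : ℝ) := by fun_prop
  exact (isClosed_eq (continuous_id.sub continuous_const) (hc.smul continuous_const)).inter
    (isClosed_le continuous_const hc)

theorem isCompact_segment (p q : ℂ) : IsCompact (segment ℝ p q) := by
  rw [segment_eq_image']
  exact isCompact_Icc.image (f := fun t : ℝ => p + t • (q - p)) (by fun_prop)

/-- An edge stays away from the vertices that are not its ends. -/
theorem eventually_notMem_path {a b c : FoldVertex φ} {z : ℂ} (h : Link φ a b z) (hca : c ≠ a)
    (hcb : c ≠ b) : ∀ᶠ x in c.nhds, x ∉ path a b z := by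
  have ray : ∀ {p u r : ℂ}, IsCreaseRay φ p u → IsVertexPoint φ r → r ≠ p →
      ∀ᶠ x in 𝓝 r, x ∉ {x | ∃ t : ℝ, 0 < t ∧ x = p + t • u} := by
    intro p u r hpu hr hrp
    refine Filter.mem_of_superset ((isClosed_ray (p := p) hpu.1).isOpen_compl.mem_nhds ?_) ?_
    · rintro ⟨t, ht, rfl⟩
      rcases ht.eq_or_lt with rfl | ht
      · simp at hrp
      · exact (hpu.2 t ht).not_isVertexPoint hr
    · rintro x hx ⟨t, ht, hxt⟩
      exact hx ⟨t, ht.le, hxt⟩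
  rcases a with ⟨p, hp⟩ | _ <;> rcases b with ⟨q, hq⟩ | _ <;> rcases c with ⟨r, hr⟩ | _
  · refine Filter.mem_of_superset ((isCompact_segment p q).isClosed.isOpen_compl.mem_nhds ?_) ?_
    · intro hx
      rw [← insert_endpoints_openSegment] at hx
      rcases hx with rfl | rfl | hx
      · exact hca rfl
      · exact hcb rfl
      · exact (h.2 r hx).not_isVertexPoint hr
    · exact fun x hx hx' => hx (openSegment_subset_segment ℝ p q hx')
  · refine Filter.mem_of_superset (isCompact_segment p q).compl_mem_cocompact ?_
    exact fun x hx hx' => hx (openSegment_subset_segment ℝ p q hx')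
  · exact ray h.1 hr (by rintro rfl; exact hca rfl)
  · exact (hcb rfl).elim
  · exact ray h.1 hr (by rintro rfl; exact hcb rfl)
  · exact (hca rfl).elim
  · exact h.elim
  · exact h.elim

/-- The direction of an edge between two points, with a default value for edges to infinity. -/
def linkDir : FoldVertex φ → FoldVertex φ → ℂ → ℂ
  | .point p _, .point q _, _ => q - p
  | .point _ _, .infinity _, z => z
  | .infinity _, _, z => z

theorem linkDir_symm : ∀ (a b : FoldVertex φ) (z : ℂ), linkDir b a (-z) = -linkDir a b z
  | .point p _, .point q _, _ => by simp [linkDir]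
  | .point _ _, .infinity _, _ => rfl
  | .infinity _, .point _ _, _ => rfl
  | .infinity _, .infinity _, _ => rfl

end Link

/-- The vertices of a folding that remain vertices of another folding. -/
def FoldVertex.lift {φ ψ : ℂ → ℂ} (hV : ∀ p, IsVertexPoint φ p → IsVertexPoint ψ p)
    (hR : ∃ p u, IsCreaseRay ψ p u) : FoldVertex φ → FoldVertex ψ
  | .point p hp => .point p (hV p hp)
  | .infinity _ => .infinity hR

section lift

variable {φ ψ : ℂ → ℂ} {hV : ∀ p, IsVertexPoint φ p → IsVertexPoint ψ p}
  {hR : ∃ p u, IsCreaseRay ψ p u}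

theorem FoldVertex.nhds_lift : ∀ a : FoldVertex φ, (a.lift hV hR).nhds = a.nhds
  | .point _ _ => rfl
  | .infinity _ => rfl

theorem FoldVertex.center_lift : ∀ a : FoldVertex φ, (a.lift hV hR).center = a.center
  | .point _ _ => rfl
  | .infinity _ => rfl

theorem FoldVertex.sgn_lift : ∀ a : FoldVertex φ, (a.lift hV hR).sgn = a.sgn
  | .point _ _ => rfl
  | .infinity _ => rfl

theorem FoldVertex.lift_injective : Function.Injective (FoldVertex.lift hV hR) := by
  rintro (⟨p, hp⟩ | _) (⟨q, hq⟩ | _) h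
  · obtain rfl : p = q := by simpa [lift] using h
    rfl
  · simp [lift] at h
  · simp [lift] at h
  · rfl

/-- An edge whose points remain crease points remains an edge. -/
theorem Link.lift {a b : FoldVertex φ} {z : ℂ} (h : Link φ a b z)
    (hc : ∀ x ∈ Link.path a b z, IsCreasePoint ψ x) :
    Link.linkDir (a.lift hV hR) (b.lift hV hR) z = z ∧
      Link ψ (a.lift hV hR) (b.lift hV hR) z := by
  rcases a with ⟨p, hp⟩ | _ <;> rcases b with ⟨q, hq⟩ | _
  · exact ⟨h.1.symm, h.1, hc⟩
  · exact ⟨rfl, ⟨h.1.1, fun t ht => hc _ ⟨t, ht, rfl⟩⟩, h.2⟩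
  · exact ⟨rfl, ⟨h.1.1, fun t ht => hc _ ⟨t, ht, rfl⟩⟩, h.2⟩
  · exact h.elim

/-- If a point `q` of an edge becomes a vertex, then the part of the edge behind `q` is an edge. -/
theorem Link.split {a b : FoldVertex φ} {z q : ℂ} (h : Link φ a b z) (hq : q ∈ Link.path a b z)
    (hqv : IsVertexPoint ψ q) (hc : ∀ x ∈ Link.path a b z, x ≠ q → IsCreasePoint ψ x) :
    (∃ r : ℝ, 0 < r ∧ Link.linkDir (.point q hqv) (b.lift hV hR) z = r • z) ∧
      Link ψ (.point q hqv) (b.lift hV hR) (Link.linkDir (.point q hqv) (b.lift hV hR) z) := by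
  have hz := h.ne_zero
  rcases a with ⟨p, hp⟩ | _ <;> rcases b with ⟨p', hp'⟩ | _
  · rw [path, openSegment_eq_image'] at hq
    obtain ⟨t, ht, htq⟩ := hq
    have htq : q = p + t • z := by rw [← htq, h.1]
    have hp'z : p' = p + z := by rw [h.1]; ring
    refine ⟨⟨1 - t, by linarith [ht.2], ?_⟩, rfl, fun x hx => ?_⟩
    · simp only [FoldVertex.lift, linkDir]
      rw [hp'z, htq]
      module
    · rw [openSegment_eq_image'] at hx
      obtain ⟨s, hs, rfl⟩ := hx
      have e : q + s • (p' - q) = p + (t + s * (1 - t)) • z := by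
        rw [hp'z, htq]
        module
      refine hc _ ?_ ?_
      · rw [path, openSegment_eq_image']
        refine ⟨t + s * (1 - t), ⟨?_, ?_⟩, ?_⟩
        · nlinarith [ht.1, ht.2, hs.1]
        · nlinarith [ht.1, ht.2, hs.1, hs.2]
        · simp only [e, h.1]
      · intro e'
        have e' := e.symm.trans e'
        rw [htq, add_right_inj] at e'
        have := smul_left_injective ℝ hz e'
        nlinarith [ht.1, ht.2, hs.1]
  · obtain ⟨t, ht, rfl⟩ := hq
    obtain ⟨h1, s, hs, hps⟩ := h
    refine ⟨⟨1, one_pos, (one_smul ℝ z).symm⟩, ⟨h1.1, fun r hr => ?_⟩, s + t, by linarith, ?_⟩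
    · change IsCreasePoint ψ (p + t • z + r • z)
      rw [add_assoc, ← add_smul]
      refine hc _ ⟨t + r, by linarith, rfl⟩ fun e => ?_
      rw [add_right_inj] at e
      have := smul_left_injective ℝ hz e
      linarith
    · change p + t • z = (s + t) • z
      rw [add_smul, ← hps]
  · obtain ⟨t, ht, rfl⟩ := hq
    have hz' : -z ≠ 0 := neg_ne_zero.2 hz
    refine ⟨⟨t, ht, ?_⟩, rfl, fun x hx => ?_⟩
    · simp only [FoldVertex.lift, linkDir]
      module
    · rw [openSegment_symm, openSegment_eq_image'] at hx
      obtain ⟨s, hs, rfl⟩ := hx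
      have e : p' + s • (p' + t • (-z) - p') = p' + (s * t) • (-z) := by module
      refine hc _ ⟨s * t, mul_pos hs.1 ht, e⟩ fun e' => ?_
      have e' := e.symm.trans e'
      rw [add_right_inj] at e'
      have := smul_left_injective ℝ hz' e'
      nlinarith [hs.2]
  · exact h.elim

end lift

/-! ## The corners of the polygon that is folded over -/

/-- Folding a cone along a line `⟪a, ·⟫ = c` that crosses all creases produces, on each crease, the
apex of a new cone. -/
theorem IsCone.corner {m n a : ℂ} {z : Fin 4 → ℂ} (h : IsCone m n z) {c : ℝ}
    (hc : ∀ i, inner ℝ a (coneFold m n (z i)) = c) (hc0 : c ≠ 0) {σ : ℝ} (hσ : ‖σ • a‖ = 1)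
    (i : Fin 4) : ∃ (B : ℂ ≃ₗᵢ[ℝ] ℂ) (k : ℂ), inner ℝ k (z i) = 0 ∧
      (∀ᶠ x in 𝓝 (z i), coneFold m n x = B (halfFold k x)) ∧
      ∀ s s' : ℝ, s * s' < 0 →
        IsCone k (B.symm (σ • a)) ![s • z i, z (i + 1) - z i, s' • z i, z (i - 1) - z i] := by
  obtain ⟨B, k, hk, hki, hk1, hk2, hB⟩ := h.eventually_crease i
  refine ⟨B, k, hki, hB, fun s s' hs => ?_⟩
  have hzi : halfFold k (z i) = z i := halfFold_of_nonpos hki.le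
  have hBi : inner ℝ a (B (z i)) = c := by
    rw [← hc i, hB.self_of_nhds, hzi]
  have hinner : ∀ w, inner ℝ (B.symm (σ • a)) w = σ * inner ℝ a (B w) := by
    intro w
    rw [← B.inner_map_map, B.apply_symm_apply, real_inner_smul_left]
  have hσ0 : σ ≠ 0 := by
    rintro rfl
    simp at hσ
  -- If the height is constant on the segment from `z i` towards `w`, then the local form of the
  -- cone at `z i`, evaluated at a single small `t`, shows that the folded direction of the segment
  -- is orthogonal to the axis.
  have key : ∀ w : ℂ, (∀ t : ℝ, 0 < t → t < 1 →
      inner ℝ a (coneFold m n (z i + t • (w - z i))) = c) →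
      inner ℝ a (B (halfFold k (w - z i))) = 0 := by
    intro w hw
    obtain ⟨t, ⟨h1, h2⟩⟩ := ((eventually_smul_add hB (w - z i)).and
      (Ioo_mem_nhdsGT (zero_lt_one' ℝ))).exists
    have h3 := hw t h2.1 h2.2
    rw [h1, halfFold_add (by rw [hki, zero_mul]), hzi, halfFold_smul _ _ h2.1.le, map_add,
      map_smul, inner_add_right, hBi, real_inner_smul_right] at h3
    have h4 : t * inner ℝ a (B (halfFold k (w - z i))) = 0 := by linarith
    exact (mul_eq_zero.1 h4).resolve_left h2.1.ne'
  -- The cone is linear on the sector between adjacent creases, so the height is constant on the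
  -- side joining two points of equal height.
  have hnext := key (z (i + 1)) fun t h0 h1 => by
    rw [show z i + t • (z (i + 1) - z i) = (1 - t) • z i + t • z (i + 1) by module,
      (h.isSector i).coneFold_combo (by linarith) h0.le, inner_add_right, real_inner_smul_right,
      real_inner_smul_right, hc, hc]
    ring
  have hprev := key (z (i - 1)) fun t h0 h1 => by
    have hsec := h.isSector (i - 1)
    rw [sub_add_cancel] at hsec
    rw [show z i + t • (z (i - 1) - z i) = t • z (i - 1) + (1 - t) • z i by module,
      hsec.coneFold_combo h0.le (by linarith), inner_add_right, real_inner_smul_right,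
      real_inner_smul_right, hc, hc]
    ring
  have hk1' : inner ℝ k (z (i + 1) - z i) < 0 := by
    rw [inner_sub_right, hki, sub_zero]
    exact hk1
  rw [halfFold_of_nonpos hk1'.le] at hnext
  exact
    { norm_m := hk
      norm_n := by rw [LinearIsometryEquiv.norm_map, hσ]
      m0 := by
        change inner ℝ k (s • z i) = 0
        rw [real_inner_smul_right, hki, mul_zero]
      m1 := hk1'
      m2 := by
        change inner ℝ k (s' • z i) = 0
        rw [real_inner_smul_right, hki, mul_zero]
      m3 := by
        change 0 < inner ℝ k (z (i - 1) - z i)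
        rw [inner_sub_right, hki, sub_zero]
        exact hk2
      n1 := by
        change inner ℝ _ (z (i + 1) - z i) = 0
        rw [hinner, hnext, mul_zero]
      n3 := by
        change inner ℝ _ (halfFold k (z (i - 1) - z i)) = 0
        rw [hinner, hprev, mul_zero]
      n02 := by
        change inner ℝ _ (s • z i) * inner ℝ _ (s' • z i) < 0
        rw [real_inner_smul_right, real_inner_smul_right, hinner, hBi, mul_mul_mul_comm]
        exact mul_neg_of_neg_of_pos hs (mul_self_pos.2 (mul_ne_zero hσ0 hc0)) }

/-! ## Folding over a corner -/

/-- The interior points of the edge that is described by the dart `d`. -/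
def FoldModel.path {G : RotationSystem} {φ : ℂ → ℂ} (M : FoldModel G φ) (d : G.D) : Set ℂ :=
  Link.path (M.onV (G.tail d)) (M.onV (G.tail (G.rev d))) (M.dir d)

/-- The cone at the vertex `v`, together with a line `⟪axis, ·⟫ = c` that crosses its image. -/
structure CornerCut {G : RotationSystem} {φ : ℂ → ℂ} (M : FoldModel G φ) (v : G.V) where
  w : Fin 4 → G.D
  m : ℂ
  n : ℂ
  b : ℂ
  L : ℂ ≃ₗᵢ[ℝ] ℂ
  cone : ConeAt G φ M.dir v (M.onV v) w m n b L
  axis : ℂ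
  norm_axis : ‖axis‖ = 1
  μ : ℝ
  μ_pos : 0 < μ
  le_inner : ∀ z, μ * ‖z‖ ≤ inner ℝ axis (coneFold m n z)
  c : ℝ
  c_pos : 0 < c

namespace CornerCut

variable {G : RotationSystem} {φ : ℂ → ℂ} {M : FoldModel G φ} {v : G.V} (F : CornerCut M v)

/-- The centre of the cone. -/
def center (_ : CornerCut M v) : ℂ := (M.onV v).center

/-- The sign of the vertex. -/
def sgn (_ : CornerCut M v) : ℝ := (M.onV v).sgn

/-- The height of the image of a point of the cone in the direction of the axis. -/
noncomputable def height (x : ℂ) : ℝ := inner ℝ F.axis (coneFold F.m F.n (x - F.center))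

/-- The side of the line on which the image of a point lies; it is positive near `v`. -/
noncomputable def level (x : ℂ) : ℝ := -F.sgn * (F.height x - F.c)

/-- The unit normal vector of the line in the image plane, pointing towards the corner. -/
noncomputable def normal : ℂ := F.L (-F.sgn • F.axis)

/-- The folding that arises when the corner is folded over. -/
noncomputable def folded (x : ℂ) : ℂ := φ x - (2 * max (F.level x) 0 : ℝ) • F.normal

/-- The region around `v` in which `φ` is described by the cone. -/
structure Admissible (x : ℂ) : Prop where
  germ : φ x = F.b + F.L (coneFold F.m F.n (x - F.center))
  vertex : ∀ hx : IsVertexPoint φ x, M.onV v = .point x hx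
  avoid : ∀ d, G.tail d ≠ v → G.tail (G.rev d) ≠ v → x ∉ M.path d
  follow : ∀ d, G.tail d = v → ∀ t : ℝ, 0 < t → x = F.center + t • (F.sgn • M.dir d) →
    x ∈ M.path d

/-- The line is so close to the corner that the part of the plane that is folded over is
admissible. -/
structure IsSmall : Prop where
  admissible : ∀ᶠ x in (M.onV v).nhds, F.Admissible x
  side : ∀ᶠ x in (M.onV v).nhds, 0 < F.level x
  near : ∀ x, 0 ≤ F.level x → ∀ᶠ x' in 𝓝 x, F.Admissible x'

theorem sgn_eq_or : F.sgn = 1 ∨ F.sgn = -1 := FoldVertex.sgn_eq_or _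

theorem sgn_mul_self : F.sgn * F.sgn = 1 := by
  rcases F.sgn_eq_or with h | h <;> rw [h] <;> norm_num

theorem sgn_ne_zero : F.sgn ≠ 0 := left_ne_zero_of_mul_eq_one F.sgn_mul_self

theorem norm_sgn_smul_axis : ‖-F.sgn • F.axis‖ = 1 := by
  rw [norm_smul, F.norm_axis, norm_neg]
  rcases F.sgn_eq_or with h | h <;> simp [h]

theorem norm_normal : ‖F.normal‖ = 1 := by
  rw [normal, LinearIsometryEquiv.norm_map, norm_sgn_smul_axis]

@[fun_prop]
theorem continuous_height : Continuous F.height := by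
  unfold height
  fun_prop

@[fun_prop]
theorem continuous_level : Continuous F.level := by
  unfold level
  fun_prop

theorem continuous_folded : Continuous F.folded := by
  have := M.cont
  unfold folded
  fun_prop

theorem height_le (x : ℂ) : F.height x ≤ ‖x - F.center‖ := by
  have := real_inner_le_norm F.axis (coneFold F.m F.n (x - F.center))
  rwa [F.norm_axis, one_mul, F.cone.isCone.norm_coneFold] at this

theorem le_height (x : ℂ) : F.μ * ‖x - F.center‖ ≤ F.height x := F.le_inner _

theorem height_center : F.height F.center = 0 := by simp [height]

theorem height_add_smul {t : ℝ} (ht : 0 ≤ t) (z : ℂ) :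
    F.height (F.center + t • z) = t * F.height (F.center + z) := by
  simp only [height, add_sub_cancel_left]
  rw [coneFold_smul _ _ _ ht, real_inner_smul_right]

theorem level_eq_zero {x : ℂ} : F.level x = 0 ↔ F.height x = F.c := by
  simp [level, F.sgn_ne_zero, sub_eq_zero]

/-- The level is defined on the whole plane through the cone alone. Only where `φ` agrees with the
cone does it measure the signed distance of `φ x` from the line. -/
theorem level_eq_inner {x : ℂ} (h : F.Admissible x) :
    F.level x = inner ℝ F.normal (φ x) - (inner ℝ F.normal F.b - F.sgn * F.c) := by
  rw [h.germ, inner_add_right, normal, F.L.inner_map_map, real_inner_smul_left, level, height]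
  ring

theorem folded_of_level_nonpos {x : ℂ} (h : F.level x ≤ 0) : F.folded x = φ x := by
  simp [folded, max_eq_right h]

theorem folded_of_level_nonneg {x : ℂ} (h : 0 ≤ F.level x) (hx : F.Admissible x) :
    F.folded x = reflectAcross F.normal (inner ℝ F.normal F.b - F.sgn * F.c) (φ x) := by
  rw [folded, max_eq_left h, F.level_eq_inner hx, reflectAcross, Complex.real_smul]

theorem eventually_folded_of_neg {x : ℂ} (h : F.level x < 0) :
    ∀ᶠ x' in 𝓝 x, F.folded x' = IsometryEquiv.refl ℂ (φ x') := by
  filter_upwards [F.continuous_level.continuousAt.eventually_lt continuousAt_const h] with x' hx'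
  exact F.folded_of_level_nonpos hx'.le

/-- The reflection of the image plane. -/
noncomputable def reflection : ℂ ≃ᵢ ℂ :=
  (mirror F.normal).toIsometryEquiv.trans
    (IsometryEquiv.addRight ((2 * (inner ℝ F.normal F.b - F.sgn * F.c) : ℝ) • F.normal))

theorem reflection_apply (z : ℂ) :
    F.reflection z = reflectAcross F.normal (inner ℝ F.normal F.b - F.sgn * F.c) z := by
  have : F.reflection z =
      mirror F.normal z + (2 * (inner ℝ F.normal F.b - F.sgn * F.c) : ℝ) • F.normal := rfl
  rw [this, mirror_apply F.norm_normal, reflectAcross, ← Complex.real_smul]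
  module

/-! ### The new folding on and off the folding line -/

section small

variable {F} (hF : F.IsSmall)
include hF

theorem eventually_folded_of_pos {x : ℂ} (h : 0 < F.level x) :
    ∀ᶠ x' in 𝓝 x, F.folded x' = F.reflection (φ x') := by
  filter_upwards [continuousAt_const.eventually_lt F.continuous_level.continuousAt h,
    hF.near x h.le] with x' hx' hx''
  rw [F.folded_of_level_nonneg hx'.le hx'', reflection_apply]

theorem eventually_folded {x : ℂ} (h : F.level x ≠ 0) :
    ∃ σ : ℂ ≃ᵢ ℂ, ∀ᶠ x' in 𝓝 x, F.folded x' = σ (φ x') := by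
  rcases h.lt_or_gt with h | h
  · exact ⟨_, F.eventually_folded_of_neg h⟩
  · exact ⟨_, eventually_folded_of_pos hF h⟩

/-- The folding near a point of the folding line. -/
theorem germ_of_level_eq_zero {x : ℂ} (h : F.level x = 0) {B : ℂ ≃ₗᵢ[ℝ] ℂ} {g : ℂ → ℂ}
    (hg : g 0 = 0) (hB : ∀ᶠ z in 𝓝 (x - F.center),
      coneFold F.m F.n z = B (x - F.center + g (z - (x - F.center)))) :
    ∀ᶠ x' in 𝓝 x, F.folded x' =
      φ x + (B.trans F.L) (halfFold (B.symm (-F.sgn • F.axis)) (g (x' - x))) := by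
  have h0 := hB.self_of_nhds
  rw [sub_self, hg, add_zero] at h0
  have hx := (hF.near x h.ge).self_of_nhds.germ
  have ht : Tendsto (fun x' => x' - F.center) (𝓝 x) (𝓝 (x - F.center)) :=
    (continuous_id.sub continuous_const).tendsto x
  rw [F.level_eq_zero, height, h0] at h
  filter_upwards [hF.near x (F.level_eq_zero.2 (by rw [height, h0, h])).ge, ht.eventually hB]
    with x' hx' hB'
  rw [sub_sub_sub_cancel_right, map_add] at hB'
  have hBn : B (B.symm (-F.sgn • F.axis)) = -F.sgn • F.axis := B.apply_symm_apply _
  generalize B.symm (-F.sgn • F.axis) = n' at hBn ⊢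
  -- As `x` has level 0, the constants cancel and the level becomes a linear function of the local
  -- displacement: precisely what the second fold tests.
  have hl : F.level x' = inner ℝ n' (g (x' - x)) := by
    rw [level, height, hB', inner_add_right, h, ← B.inner_map_map n', hBn, real_inner_smul_left]
    ring
  have e : (B.trans F.L) (halfFold n' (g (x' - x))) =
      F.L (B (g (x' - x))) - (2 * max (F.level x') 0 : ℝ) • F.normal := by
    rw [LinearIsometryEquiv.trans_apply, halfFold, map_sub, map_smul, hBn, map_sub, map_smul, hl,
      normal]
  rw [folded, hx'.germ, hx, h0, hB', e, map_add]
  ring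

end small

/-! ### The corners of the polygon -/

theorem height_pos (d : G.D) : 0 < F.height (F.center + F.sgn • M.dir d) := by
  refine lt_of_lt_of_le (mul_pos F.μ_pos (norm_pos_iff.2 ?_)) (F.le_height _)
  rw [add_sub_cancel_left]
  exact smul_ne_zero F.sgn_ne_zero (M.link d).ne_zero

/-- The factor by which the direction of a dart is stretched to reach the folding line. -/
noncomputable def factor (d : G.D) : ℝ := F.c / F.height (F.center + F.sgn • M.dir d)

theorem factor_pos (d : G.D) : 0 < F.factor d := div_pos F.c_pos (F.height_pos d)

/-- The point at which a dart at `v` meets the folding line. -/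
noncomputable def corner (d : G.D) : ℂ := F.center + F.factor d • (F.sgn • M.dir d)

theorem height_corner (d : G.D) : F.height (F.corner d) = F.c := by
  rw [corner, F.height_add_smul (F.factor_pos d).le, factor, div_mul_cancel₀ _ (F.height_pos d).ne']

theorem level_corner (d : G.D) : F.level (F.corner d) = 0 := F.level_eq_zero.2 (F.height_corner d)

/-- The height is proportional to `t` along a ray from the centre, so the ray meets the folding line
only once. -/
theorem eq_corner {d : G.D} {t : ℝ} (ht : 0 ≤ t)
    (h : F.level (F.center + t • (F.sgn • M.dir d)) = 0) :
    F.center + t • (F.sgn • M.dir d) = F.corner d := by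
  rw [F.level_eq_zero, F.height_add_smul ht] at h
  rw [corner, factor, ← h, mul_div_cancel_right₀ _ (F.height_pos d).ne']

/-- The cone, with its creases stretched to the folding line. -/
theorem isCone_corner : IsCone F.m F.n fun i => F.corner (F.w i) - F.center := by
  have h := F.cone.isCone.smul (r := fun i => F.factor (F.w i)) fun i => F.factor_pos _
  convert h using 2 with i
  rw [corner, add_sub_cancel_left]
  rfl

theorem corner_injOn {d e : G.D} (hd : G.tail d = v) (he : G.tail e = v)
    (h : F.corner d = F.corner e) : d = e := by
  obtain ⟨i, rfl⟩ := F.cone.exists_eq hd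
  obtain ⟨j, rfl⟩ := F.cone.exists_eq he
  rw [F.isCone_corner.index_eq i j 1 one_pos (by simp only [h, one_smul])]

section small

variable {F} (hF : F.IsSmall)
include hF

/-- The shape of the folding near a corner. -/
theorem exists_cone_corner (i : Fin 4) : ∃ (m' n' b' : ℂ) (L' : ℂ ≃ₗᵢ[ℝ] ℂ),
    (∀ᶠ x in 𝓝 (F.corner (F.w i)),
      F.folded x = b' + L' (coneFold m' n' (x - F.corner (F.w i)))) ∧
    ∀ s s' : ℝ, s * s' < 0 → IsCone m' n' ![s • (F.corner (F.w i) - F.center),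
      F.corner (F.w (i + 1)) - F.corner (F.w i), s' • (F.corner (F.w i) - F.center),
      F.corner (F.w (i - 1)) - F.corner (F.w i)] := by
  obtain ⟨B, k, hk, hB, hcone⟩ := F.isCone_corner.corner (a := F.axis) (c := F.c)
    (fun j => F.height_corner (F.w j)) F.c_pos.ne' F.norm_sgn_smul_axis i
  -- With `g` the fold along the old crease, the new line contributes the second fold of a cone.
  refine ⟨k, _, _, _, germ_of_level_eq_zero hF (F.level_corner (F.w i)) (B := B)
    (g := halfFold k) (halfFold_zero k) ?_, fun s s' hs => ?_⟩
  · filter_upwards [hB] with z hz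
    rw [hz]
    congr 1
    have h1 : halfFold k (F.corner (F.w i) - F.center) = F.corner (F.w i) - F.center :=
      halfFold_of_nonpos hk.le
    conv_lhs => rw [← add_sub_cancel (F.corner (F.w i) - F.center) z,
      halfFold_add (by rw [hk, zero_mul]), h1]
  · have := hcone s s' hs
    simpa only [sub_sub_sub_cancel_right] using this

theorem isVertexPoint_corner {d : G.D} (hd : G.tail d = v) :
    IsVertexPoint F.folded (F.corner d) := by
  obtain ⟨i, rfl⟩ := F.cone.exists_eq hd
  obtain ⟨m', n', b', L', h1, h2⟩ := exists_cone_corner hF i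
  have h3 := h2 1 (-1) (by norm_num)
  exact isVertexPoint_of_eventually h3.norm_m h3.norm_n h3.m1 h3.n1 h1

/-- Off the old creases the cone is locally an isometry, so only the fold along the new line
remains. -/
theorem isCreasePoint_of_level_eq_zero {x : ℂ} (h : F.level x = 0)
    (hm : inner ℝ F.m (x - F.center) ≠ 0) (hn : inner ℝ F.n (halfFold F.m (x - F.center)) ≠ 0) :
    IsCreasePoint F.folded x := by
  obtain ⟨B, hB⟩ := coneFold_eventually F.cone.isCone.norm_m F.cone.isCone.norm_n hm hn
  refine isCreasePoint_of_eventually (n := B.symm (-F.sgn • F.axis))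
    (by rw [LinearIsometryEquiv.norm_map, norm_sgn_smul_axis])
    (germ_of_level_eq_zero hF h (B := B) (g := id) rfl ?_)
  filter_upwards [hB] with z hz
  rw [hz, id, add_sub_cancel]

theorem cases_of_level_eq_zero {x : ℂ} (h : F.level x = 0) :
    IsCreasePoint F.folded x ∨ ∃ d, G.tail d = v ∧ x = F.corner d := by
  by_cases hx : inner ℝ F.m (x - F.center) = 0 ∨ inner ℝ F.n (halfFold F.m (x - F.center)) = 0
  · right
    have hx0 : x - F.center ≠ 0 := by
      intro h0
      rw [F.level_eq_zero, sub_eq_zero.1 h0, height_center] at h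
      exact F.c_pos.ne h
    obtain ⟨i, t, ht, hi⟩ := F.cone.isCone.exists_ray hx0 hx
    refine ⟨F.w i, F.cone.tail i, ?_⟩
    have hx' : x = F.center + t • (F.sgn • M.dir (F.w i)) := by
      rw [sub_eq_iff_eq_add'] at hi
      exact hi
    rw [hx'] at h ⊢
    exact F.eq_corner ht.le h
  · push Not at hx
    exact Or.inl (isCreasePoint_of_level_eq_zero hF h hx.1 hx.2)

/-- The sides of the polygon become creases. -/
theorem isCreasePoint_side {d : G.D} (hd : G.tail d = v) {x : ℂ}
    (hx : x ∈ openSegment ℝ (F.corner d) (F.corner (G.rot d))) : IsCreasePoint F.folded x := by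
  obtain ⟨i, rfl⟩ := F.cone.exists_eq hd
  rw [F.cone.rot] at hx
  obtain ⟨s, t, hs, ht, hst, rfl⟩ := hx
  have hsec := F.isCone_corner.isSector i
  have e : s • F.corner (F.w i) + t • F.corner (F.w (i + 1)) - F.center =
      s • (F.corner (F.w i) - F.center) + t • (F.corner (F.w (i + 1)) - F.center) := by
    obtain rfl : s = 1 - t := by linarith
    module
  refine isCreasePoint_of_level_eq_zero hF ?_ ?_ ?_
  · rw [F.level_eq_zero, height, e, hsec.coneFold_combo hs.le ht.le, inner_add_right,
      real_inner_smul_right, real_inner_smul_right]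
    change s * F.height _ + t * F.height _ = F.c
    rw [height_corner, height_corner, ← add_mul, hst, one_mul]
  · rw [e]
    exact hsec.combo_m_ne hs ht
  · rw [e]
    exact hsec.combo_n_ne hs ht

/-! ### Crease points and vertex points -/

theorem isCreasePoint_folded {x : ℂ} (h : F.level x ≠ 0) (hx : IsCreasePoint φ x) :
    IsCreasePoint F.folded x := by
  obtain ⟨σ, hσ⟩ := eventually_folded hF h
  exact hx.comp_isometry hσ

theorem level_neg_of_ne {y : G.V} (hy : y ≠ v) {p : ℂ} {hp : IsVertexPoint φ p}
    (h : M.onV y = .point p hp) : F.level p < 0 := by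
  by_contra! hl
  exact hy (M.onV.injective (h.trans ((hF.near p hl).self_of_nhds.vertex hp).symm))

/-- A vertex point of nonnegative level can only be `v` itself, hence the centre, where the height
is 0 and not `c`. -/
theorem level_vertex_ne_zero {p : ℂ} (hp : IsVertexPoint φ p) : F.level p ≠ 0 := by
  intro h
  have h1 := (hF.near p h.ge).self_of_nhds.vertex hp
  have h2 : F.center = p := by rw [center, h1]; rfl
  rw [F.level_eq_zero, ← h2, height_center] at h
  exact F.c_pos.ne h

theorem isVertexPoint_folded (p : ℂ) (hp : IsVertexPoint φ p) : IsVertexPoint F.folded p := by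
  obtain ⟨σ, hσ⟩ := eventually_folded hF (level_vertex_ne_zero hF hp)
  exact hp.comp_isometry hσ

theorem isVertexPoint_or {x : ℂ} (hx : IsVertexPoint F.folded x) :
    IsVertexPoint φ x ∨ ∃ d, G.tail d = v ∧ x = F.corner d := by
  by_cases h : F.level x = 0
  · exact Or.inr ((cases_of_level_eq_zero hF h).resolve_left fun h' => h'.not_isVertexPoint hx)
  · obtain ⟨σ, hσ⟩ := eventually_folded hF h
    rcases M.cases_point x with h1 | h1 | h1
    · exact (hx.1 (h1.comp_isometry hσ)).elim
    · exact ((h1.comp_isometry hσ).not_isVertexPoint hx).elim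
    · exact Or.inl h1

theorem cases_point_folded (x : ℂ) :
    IsUnfoldedPoint F.folded x ∨ IsCreasePoint F.folded x ∨ IsVertexPoint F.folded x := by
  by_cases h : F.level x = 0
  · rcases cases_of_level_eq_zero hF h with h1 | ⟨d, hd, rfl⟩
    · exact Or.inr (Or.inl h1)
    · exact Or.inr (Or.inr (isVertexPoint_corner hF hd))
  · obtain ⟨σ, hσ⟩ := eventually_folded hF h
    rcases M.cases_point x with h1 | h1 | h1
    · exact Or.inl (h1.comp_isometry hσ)
    · exact Or.inr (Or.inl (h1.comp_isometry hσ))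
    · exact Or.inr (Or.inr (h1.comp_isometry hσ))

/-- This keeps ∞ among the vertices. The far end of an old ray lies off the folding line, so it
still consists of crease points. -/
theorem exists_ray_folded : ∃ p u, IsCreaseRay F.folded p u := by
  obtain ⟨p, u, hu, h⟩ := M.exists_ray
  -- Points of height `c` are within `c / μ` of the centre; the second summand accounts for the
  -- starting point of the ray.
  obtain ⟨T, hT⟩ : ∃ T : ℝ, T = F.c / F.μ + ‖p - F.center‖ := ⟨_, rfl⟩
  have hT0 : 0 ≤ T := hT ▸ add_nonneg (div_nonneg F.c_pos.le F.μ_pos.le) (norm_nonneg _)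
  refine ⟨p + T • u, u, hu, fun t ht => ?_⟩
  have e : p + T • u + t * u = p + (T + t) • u := by
    rw [add_smul, add_assoc, ← Complex.real_smul]
  rw [e]
  refine isCreasePoint_folded hF ?_ (h (T + t) (by linarith))
  intro h0
  rw [F.level_eq_zero] at h0
  have h1 := F.le_height (p + (T + t) • u)
  have h2 : T + t ≤ ‖p + (T + t) • u - F.center‖ + ‖p - F.center‖ := by
    have h3 : ‖(T + t) • u‖ = T + t := by
      rw [norm_smul, hu, mul_one, Real.norm_of_nonneg (by linarith)]
    calc T + t = ‖(T + t) • u‖ := h3.symm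
      _ = ‖(p + (T + t) • u - F.center) - (p - F.center)‖ := by congr 1; ring
      _ ≤ _ := norm_sub_le _ _
  rw [h0] at h1
  have h4 : ‖p + (T + t) • u - F.center‖ ≤ F.c / F.μ := by
    rw [le_div_iff₀ F.μ_pos]
    linarith
  linarith

theorem isCreasePoint_of_mem_path_of_ne {d : G.D} (h1 : G.tail d ≠ v) (h2 : G.tail (G.rev d) ≠ v)
    {x : ℂ} (hx : x ∈ M.path d) : IsCreasePoint F.folded x := by
  refine isCreasePoint_folded hF (fun h => ?_) ((M.link d).isCreasePoint hx)
  exact (hF.near x h.ge).self_of_nhds.avoid d h1 h2 hx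

theorem isCreasePoint_of_mem_path {d : G.D} (hd : G.tail d = v) {x : ℂ} (hx : x ∈ M.path d)
    (hne : x ≠ F.corner d) : IsCreasePoint F.folded x := by
  refine isCreasePoint_folded hF (fun h => hne ?_) ((M.link d).isCreasePoint hx)
  obtain ⟨t, ht, e⟩ := (M.link d).exists_eq_of_mem_path hx
  rw [hd] at e
  change x = F.center + t • (F.sgn • M.dir d) at e
  rw [e] at h ⊢
  exact F.eq_corner ht.le h

theorem corner_mem_path {d : G.D} (hd : G.tail d = v) : F.corner d ∈ M.path d :=
  (hF.near _ (F.level_corner d).ge).self_of_nhds.follow d hd _ (F.factor_pos d) rfl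

end small

end CornerCut

/-! ### The graph after folding over a corner -/

namespace RotationSystem.WheelDart

variable {G : RotationSystem} {v : G.V}

theorem tail_old_of_eq {d : G.D} (h : G.tail d = v) :
    (old d : WheelDart G v).tail = Sum.inr ⟨d, h⟩ := by
  simp [tail, h]

theorem tail_old_of_ne {d : G.D} (h : G.tail d ≠ v) :
    (old d : WheelDart G v).tail = Sum.inl (G.tail d) := by
  simp [tail, h]

theorem rev_rev (δ : WheelDart G v) : δ.rev.rev = δ := (G.wheelReplace v).rev_rev δ

end RotationSystem.WheelDart

/-- The subtracted multiple of `x` does not contribute: at a corner, the orientation between a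
crease and a side is inherited from the two adjacent creases. -/
theorem cross_smul_corner (r t s σ : ℝ) (x y : ℂ) :
    cross (r • x) (t • (σ • y) - s • (σ • x)) = r * t * (σ * cross x y) := by
  simp [cross]
  ring

theorem cross_swap (x y : ℂ) : cross x y = -cross y x := by
  simp [cross]
  ring

namespace CornerCut

open RotationSystem

variable {G : RotationSystem} {φ : ℂ → ℂ} {M : FoldModel G φ} {v : G.V} {F : CornerCut M v}

/-- The vertices of the folding, as vertices of the folding with the corner folded over. -/
noncomputable def lift (hF : F.IsSmall) : FoldVertex φ → FoldVertex F.folded :=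
  FoldVertex.lift (isVertexPoint_folded hF) (exists_ray_folded hF)

/-- The correspondence between the vertices after wheel replacement and the vertices after
folding over the corner. -/
noncomputable def wheelVertex (hF : F.IsSmall) : G.V ⊕ G.DartsAt v → FoldVertex F.folded
  | .inl y => lift hF (M.onV y)
  | .inr x => .point (F.corner x.1) (isVertexPoint_corner hF x.2)

theorem level_vertex (hF : F.IsSmall) {a : FoldVertex φ} {p : ℂ} {hp : IsVertexPoint F.folded p}
    (h : lift hF a = .point p hp) : F.level p ≠ 0 := by
  rcases a with ⟨q, hq⟩ | _
  · obtain rfl : q = p := by simpa [lift, FoldVertex.lift] using h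
    exact level_vertex_ne_zero hF hq
  · simp [lift, FoldVertex.lift] at h

/-- Corners have level 0 and old vertex points do not, so the two kinds never coincide. -/
theorem wheelVertex_bijective (hF : F.IsSmall) : Function.Bijective (wheelVertex hF) := by
  constructor
  · rintro (y | x) (y' | x') h
    · exact congrArg Sum.inl (M.onV.injective (FoldVertex.lift_injective h))
    · exact (level_vertex hF h (F.level_corner _)).elim
    · exact (level_vertex hF h.symm (F.level_corner _)).elim
    · have h : F.corner x.1 = F.corner x'.1 := by simpa [wheelVertex] using h
      exact congrArg Sum.inr (Subtype.ext (F.corner_injOn x.2 x'.2 h))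
  · rintro (⟨p, hp⟩ | _)
    · rcases isVertexPoint_or hF hp with h | ⟨d, hd, rfl⟩
      · exact ⟨.inl (M.onV.symm (.point p h)), by
          simp [wheelVertex, lift, FoldVertex.lift]⟩
      · exact ⟨.inr ⟨d, hd⟩, rfl⟩
    · exact ⟨.inl (M.onV.symm (.infinity M.exists_ray)), by
        simp [wheelVertex, lift, FoldVertex.lift]⟩

/-- The directions of the edges to infinity. -/
def wheelBase (M : FoldModel G φ) : WheelDart G v → ℂ
  | .old d => M.dir d
  | .fwd _ => 0
  | .bwd _ => 0
  | .spoke x => -M.dir x.1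
  | .hub x => M.dir x.1

theorem wheelBase_rev (δ : WheelDart G v) : wheelBase M δ.rev = -wheelBase M δ := by
  cases δ <;> simp [wheelBase, WheelDart.rev, M.dir_rev]

/-- The directions of the edges after folding over the corner. -/
noncomputable def wheelDir (hF : F.IsSmall) (δ : WheelDart G v) : ℂ :=
  Link.linkDir (wheelVertex hF δ.tail) (wheelVertex hF δ.rev.tail) (wheelBase M δ)

theorem wheelDir_rev (hF : F.IsSmall) (δ : WheelDart G v) :
    wheelDir hF δ.rev = -wheelDir hF δ := by
  rw [wheelDir, wheelBase_rev, WheelDart.rev_rev, Link.linkDir_symm, wheelDir]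

/-- The dart `δ` corresponds to an edge after folding over the corner. -/
def IsLinked (hF : F.IsSmall) (δ : WheelDart G v) : Prop :=
  Link F.folded (wheelVertex hF δ.tail) (wheelVertex hF δ.rev.tail) (wheelDir hF δ)

theorem IsLinked.rev {hF : F.IsSmall} {δ : WheelDart G v} (h : IsLinked hF δ) :
    IsLinked hF δ.rev := by
  rw [IsLinked, wheelDir_rev, WheelDart.rev_rev]
  exact Link.symm h

/-- An edge at `v` keeps only the part behind its corner, with the same direction up to a positive
factor. Edges not at `v` avoid the folding line and stay whole. -/
theorem linked_old (hF : F.IsSmall) (d : G.D) :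
    (∃ r : ℝ, 0 < r ∧ wheelDir hF (.old d) = r • M.dir d) ∧ IsLinked hF (.old d) := by
  have at_v : ∀ d, G.tail d = v →
      (∃ r : ℝ, 0 < r ∧ wheelDir hF (.old d) = r • M.dir d) ∧ IsLinked hF (.old d) := by
    intro d h
    -- An edge has different ends, so it is cut at most once.
    have h' : G.tail (G.rev d) ≠ v := fun e => (M.link d).ne (by rw [h, e])
    unfold IsLinked wheelDir
    rw [WheelDart.rev, WheelDart.tail_old_of_eq h, WheelDart.tail_old_of_ne h']
    exact (M.link d).split (corner_mem_path hF h) (isVertexPoint_corner hF h)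
      fun x hx hne => isCreasePoint_of_mem_path hF h hx hne
  by_cases h : G.tail d = v
  · exact at_v d h
  by_cases h' : G.tail (G.rev d) = v
  · obtain ⟨⟨r, hr, h1⟩, h2⟩ := at_v _ h'
    have h3 := h2.rev
    have h4 := wheelDir_rev hF (.old (G.rev d))
    rw [WheelDart.rev, G.rev_rev] at h3 h4
    exact ⟨⟨r, hr, by rw [h4, h1, M.dir_rev, smul_neg, neg_neg]⟩, h3⟩
  · have h1 := (M.link d).lift (hV := isVertexPoint_folded hF) (hR := exists_ray_folded hF)
      fun x hx => isCreasePoint_of_mem_path_of_ne hF h h' hx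
    have h2 : wheelDir hF (.old d) = M.dir d := by
      rw [wheelDir, WheelDart.rev, WheelDart.tail_old_of_ne h, WheelDart.tail_old_of_ne h']
      exact h1.1
    refine ⟨⟨1, one_pos, by rw [h2, one_smul]⟩, ?_⟩
    rw [IsLinked, h2, WheelDart.rev, WheelDart.tail_old_of_ne h, WheelDart.tail_old_of_ne h']
    exact h1.2

/-- The spoke is the part of the old edge on the side of `v`, obtained by splitting the reversed
edge at the same corner. -/
theorem linked_spoke (hF : F.IsSmall) (x : G.DartsAt v) :
    (∃ r : ℝ, 0 < r ∧ wheelDir hF (.spoke x) = r • -M.dir x.1) ∧ IsLinked hF (.spoke x) := by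
  have hl := (M.link x.1).symm
  have hp := Link.path_symm (M.onV (G.tail x.1)) (M.onV (G.tail (G.rev x.1))) (M.dir x.1)
  rw [x.2] at hl hp
  refine hl.split ?_ (isVertexPoint_corner hF x.2) fun y hy hne => ?_
  · have := corner_mem_path hF x.2
    rw [FoldModel.path, x.2] at this
    rwa [hp]
  · refine isCreasePoint_of_mem_path hF x.2 ?_ hne
    rw [FoldModel.path, x.2]
    rwa [hp] at hy

theorem isLinked (hF : F.IsSmall) : ∀ δ : WheelDart G v, IsLinked hF δ
  | .old d => (linked_old hF d).2
  | .fwd x => ⟨rfl, fun _ hy => isCreasePoint_side hF x.2 hy⟩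
  | .bwd x => IsLinked.rev (δ := .fwd x) ⟨rfl, fun _ hy => isCreasePoint_side hF x.2 hy⟩
  | .spoke x => (linked_spoke hF x).2
  | .hub x => (linked_spoke hF x).2.rev

theorem exists_wheelDir_hub (hF : F.IsSmall) (x : G.DartsAt v) :
    ∃ r : ℝ, 0 < r ∧ wheelDir hF (.hub x) = r • M.dir x.1 := by
  obtain ⟨r, hr, h⟩ := (linked_spoke hF x).1
  refine ⟨r, hr, ?_⟩
  have := wheelDir_rev hF (.spoke x)
  rw [h, smul_neg, neg_neg] at this
  exact this

/-- A cone survives when its darts are replaced by darts in the same directions and its map is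
followed by an isometry. -/
theorem _root_.ConeAt.transport {y : G.V} {a : FoldVertex φ} {w : Fin 4 → G.D} {m n b : ℂ}
    {L : ℂ ≃ₗᵢ[ℝ] ℂ} (h : ConeAt G φ M.dir y a w m n b L) {H : RotationSystem} {ψ : ℂ → ℂ}
    {dir : H.D → ℂ} {y' : H.V} {a' : FoldVertex ψ} {w' : Fin 4 → H.D} (hw : ∀ i, H.tail (w' i) = y')
    (hrot : ∀ i, H.rot (w' i) = w' (i + 1)) (hsgn : a'.sgn = a.sgn)
    (hdir : ∀ i, ∃ r : ℝ, 0 < r ∧ dir (w' i) = r • M.dir (w i)) {b' : ℂ} {L' : ℂ ≃ₗᵢ[ℝ] ℂ}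
    (hgerm : ∀ᶠ x in a'.nhds, ψ x = b' + L' (coneFold m n (x - a'.center))) :
    ConeAt H ψ dir y' a' w' m n b' L' := by
  choose r hr hrw using hdir
  refine ⟨hw, hrot, ?_, fun i => ?_, hgerm⟩
  · convert h.isCone.smul hr using 2 with i
    rw [hsgn, hrw, smul_comm]
  · rw [hsgn, hrw, hrw, cross_smul_smul, mul_left_comm]
    exact mul_pos (mul_pos (hr i) (hr _)) (h.orient i)

theorem eventually_level_neg (hF : F.IsSmall) {y : G.V} (hy : y ≠ v) :
    ∀ᶠ x in (M.onV y).nhds, F.level x < 0 := by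
  rcases hya : M.onV y with ⟨p, hp⟩ | _
  · exact F.continuous_level.continuousAt.eventually_lt continuousAt_const
      (level_neg_of_ne hF hy hya)
  -- Since another vertex is ∞, the vertex `v` is a point, and the part folded over is bounded.
  · have hs : F.sgn = 1 := by
      rcases hv : M.onV v with _ | _
      · rw [sgn, hv]; rfl
      · exact (hy (M.onV.injective (hya.trans hv.symm))).elim
    change ∀ᶠ x in cocompact ℂ, F.level x < 0
    filter_upwards [tendsto_norm_cocompact_atTop.eventually_gt_atTop (F.c / F.μ + ‖F.center‖)]
      with x hx
    have h1 := norm_sub_norm_le x F.center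
    have h2 := F.le_height x
    have h3 : F.c / F.μ < ‖x - F.center‖ := by linarith
    rw [div_lt_iff₀ F.μ_pos] at h3
    rw [level, hs]
    linarith

theorem exists_cone_inl (hF : F.IsSmall) (y : G.V) : ∃ w m n b L,
    ConeAt (G.wheelReplace v) F.folded (wheelDir hF) (.inl y) (wheelVertex hF (.inl y)) w m n b L := by
  by_cases hy : y = v
  · subst hy
    -- Everything near `v` is reflected: the cone stays the same in the source, while its apex image
    -- and its isometry are reflected.
    refine ⟨fun i => .hub ⟨F.w i, F.cone.tail i⟩, F.m, F.n, reflectAcross F.normal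
      (inner ℝ F.normal F.b - F.sgn * F.c) F.b, F.L.trans (mirror F.normal), ?_⟩
    refine F.cone.transport (fun i => ?_) (fun i => ?_) (FoldVertex.sgn_lift _)
      (fun i => exists_wheelDir_hub hF _) ?_
    · rfl
    · exact congrArg WheelDart.hub (Subtype.ext (F.cone.rot i))
    · simp only [FoldVertex.nhds_lift, FoldVertex.center_lift]
      filter_upwards [hF.side, hF.admissible] with x h1 h2
      rw [F.folded_of_level_nonneg h1.le h2, h2.germ, reflectAcross, reflectAcross,
        LinearIsometryEquiv.trans_apply, mirror_apply F.norm_normal, inner_add_right,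
        ← Complex.real_smul, ← Complex.real_smul, center]
      module
  · obtain ⟨w, m, n, b, L, hc⟩ := M.cone y
    have hw : ∀ i, G.tail (w i) ≠ v := fun i => by rwa [hc.tail]
    refine ⟨fun i => .old (w i), m, n, b, L, hc.transport (H := G.wheelReplace v) (dir := wheelDir hF)
      (fun i => ?_) (fun i => ?_)
      (FoldVertex.sgn_lift _) (fun i => (linked_old hF _).1) ?_⟩
    · change (WheelDart.old (w i) : WheelDart G v).tail = _
      rw [WheelDart.tail_old_of_ne (hw i), hc.tail]
    · change WheelDart.rotFun (.old (w i) : WheelDart G v) = _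
      simp [WheelDart.rotFun, hw i, hc.rot]
    · simp only [FoldVertex.nhds_lift, FoldVertex.center_lift]
      filter_upwards [hc.germ, eventually_level_neg hF hy] with x h1 h2
      rw [F.folded_of_level_nonpos h2.le, h1]

theorem exists_cone_inr (hF : F.IsSmall) (x : G.DartsAt v) : ∃ w m n b L,
    ConeAt (G.wheelReplace v) F.folded (wheelDir hF) (.inr x) (wheelVertex hF (.inr x)) w m n b L := by
  obtain ⟨x, hx⟩ := x
  obtain ⟨i, rfl⟩ := F.cone.exists_eq hx
  obtain ⟨m', n', b', L', hgerm, hcone⟩ := exists_cone_corner hF i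
  obtain ⟨r, hr, hold⟩ := (linked_old hF (F.w i)).1
  obtain ⟨s, hs, hspoke⟩ := (linked_spoke hF ⟨F.w i, hx⟩).1
  have hprev : (G.rotAt v).symm ⟨F.w i, hx⟩ = ⟨F.w (i - 1), F.cone.tail _⟩ := by
    rw [Equiv.symm_apply_eq]
    refine Subtype.ext ?_
    change F.w i = G.rot (F.w (i - 1))
    rw [F.cone.rot, sub_add_cancel]
  -- The rotation order at a cycle vertex matches the order of the creases at the corner: old edge,
  -- side to the next corner, spoke, side to the previous corner.
  set W : Fin 4 → WheelDart G v := ![.old (F.w i), .fwd ⟨F.w i, hx⟩, .spoke ⟨F.w i, hx⟩,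
    .bwd ⟨F.w (i - 1), F.cone.tail _⟩] with hW
  have hf := F.factor_pos (F.w i)
  have hcorner : ∀ j, F.corner (F.w j) = F.center + F.factor (F.w j) • (F.sgn • M.dir (F.w j)) :=
    fun j => rfl
  have hdiff : ∀ j, F.corner (F.w j) - F.corner (F.w i) =
      F.factor (F.w j) • (F.sgn • M.dir (F.w j)) - F.factor (F.w i) • (F.sgn • M.dir (F.w i)) := by
    intro j
    rw [hcorner, hcorner]
    ring
  have hdir : ∀ t : ℝ, t • M.dir (F.w i) =
      (t * F.sgn / F.factor (F.w i)) • (F.corner (F.w i) - F.center) := by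
    intro t
    rw [hcorner, add_sub_cancel_left, smul_smul, div_mul_cancel₀ _ hf.ne', smul_smul, mul_assoc,
      F.sgn_mul_self, mul_one]
  have d0 : wheelDir hF (W 0) = r • M.dir (F.w i) := hold
  have d1 : wheelDir hF (W 1) = F.corner (F.w (i + 1)) - F.corner (F.w i) := by
    rw [← F.cone.rot]
    rfl
  have d2 : wheelDir hF (W 2) = (-s) • M.dir (F.w i) := hspoke.trans (by rw [smul_neg, neg_smul])
  have d3 : wheelDir hF (W 3) = F.corner (F.w (i - 1)) - F.corner (F.w i) := by
    have : G.rot (F.w (i - 1)) = F.w i := by rw [F.cone.rot, sub_add_cancel]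
    rw [← this]
    rfl
  have onext := F.cone.orient i
  have oprev := F.cone.orient (i - 1)
  rw [sub_add_cancel] at oprev
  change 0 < F.sgn * _ at onext oprev
  refine ⟨W, m', n', b', L', ?_, ?_, ?_, ?_, hgerm⟩
  · refine Fin.forall_four ?_ rfl rfl ?_
    · exact WheelDart.tail_old_of_eq hx
    · change Sum.inr (G.rotAt v ⟨F.w (i - 1), _⟩) = _
      rw [← hprev, Equiv.apply_symm_apply]
  · refine Fin.forall_four ?_ rfl ?_ ?_
    · change WheelDart.rotFun (.old (F.w i)) = .fwd ⟨F.w i, hx⟩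
      simp [WheelDart.rotFun, hx]
    · exact congrArg WheelDart.bwd hprev
    · change WheelDart.old (G.rotAt v ⟨F.w (i - 1), _⟩).1 = .old (F.w i)
      rw [← hprev, Equiv.apply_symm_apply]
  -- The old edge and the spoke leave the corner in opposite directions. Which of them points away
  -- from the centre depends on the sign of `v`, but the product of the two coefficients is negative
  -- in either case.
  · have h := hcone (r * F.sgn / F.factor (F.w i)) (-s * F.sgn / F.factor (F.w i)) (by
      rw [div_mul_div_comm, mul_mul_mul_comm, F.sgn_mul_self]
      exact div_neg_of_neg_of_pos (by nlinarith) (mul_pos hf hf))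
    rw [← hdir, ← hdir, ← d0, ← d1, ← d2, ← d3] at h
    convert h using 1
    funext j
    rw [show (wheelVertex hF (.inr ⟨F.w i, hx⟩)).sgn = 1 from rfl, one_smul]
    revert j
    exact Fin.forall_four rfl rfl rfl rfl
  · have h1 : ∀ t : ℝ, 0 < t → 0 < cross (t • M.dir (F.w i)) (wheelDir hF (W 1)) := by
      intro t ht
      rw [d1, hdiff, cross_smul_corner]
      exact mul_pos (mul_pos ht (F.factor_pos _)) onext
    have h3 : ∀ t : ℝ, 0 < t → 0 < cross (wheelDir hF (W 3)) (t • M.dir (F.w i)) := by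
      intro t ht
      rw [d3, hdiff, cross_swap, cross_smul_corner, cross_swap, mul_neg, mul_neg, neg_neg]
      exact mul_pos (mul_pos ht (F.factor_pos _)) oprev
    have hneg : ∀ z z' : ℂ, cross z (-z') = cross z' z ∧ cross (-z') z = cross z z' := by
      intro z z'
      constructor <;> simp [cross] <;> ring
    rw [show (wheelVertex hF (.inr ⟨F.w i, hx⟩)).sgn = 1 from rfl]
    simp only [one_mul]
    rw [neg_smul] at d2
    refine Fin.forall_four ?_ ?_ ?_ ?_
    · rw [d0]
      exact h1 r hr
    · change 0 < cross (wheelDir hF (W 1)) (wheelDir hF (W 2))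
      rw [d2, (hneg _ _).1]
      exact h1 s hs
    · change 0 < cross (wheelDir hF (W 2)) (wheelDir hF (W 3))
      rw [d2, (hneg _ _).2]
      exact h3 s hs
    · change 0 < cross (wheelDir hF (W 3)) (wheelDir hF (W 0))
      rw [d0]
      exact h3 r hr

/-- Folding over the corner at `v` realizes the wheel replacement at `v`. -/
noncomputable def wheelModel (hF : F.IsSmall) : FoldModel (G.wheelReplace v) F.folded where
  cont := F.continuous_folded
  cases_point := cases_point_folded hF
  exists_ray := exists_ray_folded hF
  onV := Equiv.ofBijective (wheelVertex hF) (wheelVertex_bijective hF)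
  dir := wheelDir hF
  dir_rev := wheelDir_rev hF
  link := isLinked hF
  cone
    | .inl y => exists_cone_inl hF y
    | .inr x => exists_cone_inr hF x

/-- The admissible region itself serves as the neighbourhood: it contains all points of nonnegative
level, and on it the level is the signed distance from the line. -/
theorem foldsCornerOver (hF : F.IsSmall) : FoldsCornerOver φ (M.onV v) F.folded := by
  refine ⟨F.normal, inner ℝ F.normal F.b - F.sgn * F.c, {x | F.Admissible x}, F.norm_normal,
    hF.admissible, fun q hq h => h.vertex hq, ?_, fun x hx h => ?_, fun x hx => ?_⟩
  · filter_upwards [hF.side, hF.admissible] with x h1 h2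
    rw [F.level_eq_inner h2] at h1
    linarith
  · have hx : F.Admissible x := hx
    exact F.folded_of_level_nonneg (by rw [F.level_eq_inner hx]; linarith) hx
  · refine F.folded_of_level_nonpos ?_
    by_contra! h
    have hx' := (hF.near x h.le).self_of_nhds
    rw [F.level_eq_inner hx'] at h
    exact hx ⟨hx', by linarith⟩

end CornerCut

/-! ### Choosing the line close enough to the corner -/

/-- The position of a vertex among the vertices of a folding is isolated. -/
theorem FoldModel.eventually_vertex {G : RotationSystem} {φ : ℂ → ℂ} (M : FoldModel G φ) (v : G.V) :
    ∀ᶠ x in (M.onV v).nhds, ∀ hx : IsVertexPoint φ x, M.onV v = .point x hx := by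
  have := G.finite_V
  have key : ∀ y, y ≠ v → ∀ᶠ x in (M.onV v).nhds, ∀ hx : IsVertexPoint φ x,
      M.onV y ≠ .point x hx := by
    intro y hy
    rcases hya : M.onV y with ⟨p, hp⟩ | _
    · have h1 : ({p}ᶜ : Set ℂ) ∈ (M.onV v).nhds := by
        rcases hva : M.onV v with ⟨q, hq⟩ | _
        · refine isOpen_compl_singleton.mem_nhds ?_
          rintro rfl
          exact hy (M.onV.injective (hya.trans hva.symm))
        · exact isCompact_singleton.compl_mem_cocompact
      filter_upwards [h1] with x hx hx' e
      exact hx (by simpa [eq_comm] using e)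
    · exact Eventually.of_forall fun x hx e => by simp at e
  have hall : ∀ᶠ x in (M.onV v).nhds, ∀ y, y ≠ v → ∀ hx : IsVertexPoint φ x,
      M.onV y ≠ .point x hx :=
    eventually_all.2 fun y => eventually_imp_distrib_left.2 (key y)
  filter_upwards [hall] with x h hx
  by_contra hne
  refine h (M.onV.symm (.point x hx)) ?_ hx (M.onV.apply_symm_apply _)
  rintro rfl
  exact hne (M.onV.apply_symm_apply _)

/-- A line sufficiently close to a corner folds over nothing but a neighbourhood of the corner. -/
theorem FoldModel.exists_isSmall {G : RotationSystem} {φ : ℂ → ℂ} (M : FoldModel G φ) (v : G.V) :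
    ∃ F : CornerCut M v, F.IsSmall := by
  obtain ⟨w, m, n, b, L, hc⟩ := M.cone v
  obtain ⟨a, ha, μ, hμ, hle⟩ := hc.isCone.exists_axis
  let F : ∀ c : ℝ, 0 < c → CornerCut M v := fun c hc0 =>
    ⟨w, m, n, b, L, hc, a, ha, μ, hμ, hle, c, hc0⟩
  have hfin := G.finite_D
  have hadm : ∀ᶠ x in (M.onV v).nhds, (F 1 one_pos).Admissible x := by
    have h3 : ∀ᶠ x in (M.onV v).nhds, ∀ d, G.tail d ≠ v → G.tail (G.rev d) ≠ v → x ∉ M.path d :=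
      eventually_all.2 fun d => eventually_imp_distrib_left.2 fun h1 =>
        eventually_imp_distrib_left.2 fun h2 => (M.link d).eventually_notMem_path
          (fun e => h1 (M.onV.injective e).symm) (fun e => h2 (M.onV.injective e).symm)
    have h4 : ∀ᶠ x in (M.onV v).nhds, ∀ d, G.tail d = v → ∀ t : ℝ, 0 < t →
        x = (M.onV v).center + t • ((M.onV v).sgn • M.dir d) → x ∈ M.path d :=
      eventually_all.2 fun d => eventually_imp_distrib_left.2 fun h1 => by
        have := (M.link d).eventually_mem_path
        unfold path
        rwa [h1] at this ⊢
    filter_upwards [hc.germ, M.eventually_vertex v, h3, h4] with x k1 k2 k3 k4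
    exact ⟨k1, k2, k3, k4⟩
  have hadm' : ∀ c hc0 x, (F 1 one_pos).Admissible x → (F c hc0).Admissible x :=
    fun c hc0 x h => ⟨h.germ, h.vertex, h.avoid, h.follow⟩
  rcases hv : M.onV v with ⟨p, hp⟩ | _
  · have hcen : ∀ c hc0, (F c hc0).center = p := fun c hc0 => by rw [CornerCut.center, hv]; rfl
    have hsgn : ∀ c hc0, (F c hc0).sgn = 1 := fun c hc0 => by rw [CornerCut.sgn, hv]; rfl
    have hadm0 := hadm
    rw [hv] at hadm0
    have hadm0 : ∀ᶠ x in 𝓝 p, (F 1 one_pos).Admissible x := hadm0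
    obtain ⟨δ, hδ, hball⟩ := Metric.eventually_nhds_iff_ball.1 (eventually_eventually_nhds.2 hadm0)
    -- Height at most `μ * δ / 2` forces distance at most `δ / 2` from `p`, well inside the
    -- admissible ball.
    have hc0 : 0 < μ * δ / 2 := by positivity
    refine ⟨F (μ * δ / 2) hc0, hadm.mono (hadm' _ _), ?_, fun x hx => ?_⟩
    · rw [hv]
      refine continuousAt_const.eventually_lt (F _ hc0).continuous_level.continuousAt ?_
      have := (F _ hc0).height_center
      rw [hcen] at this
      rw [CornerCut.level, this, hsgn]
      change 0 < -1 * (0 - μ * δ / 2)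
      linarith
    · refine (hball x ?_).mono (hadm' _ _)
      have h1 := (F _ hc0).le_height x
      rw [hcen] at h1
      rw [CornerCut.level, hsgn] at hx
      change 0 ≤ -1 * (_ - μ * δ / 2) at hx
      change μ * _ ≤ _ at h1
      rw [Metric.mem_ball, dist_eq_norm]
      by_contra! h2
      nlinarith
  · have hcen : ∀ c hc0, (F c hc0).center = 0 := fun c hc0 => by rw [CornerCut.center, hv]; rfl
    have hsgn : ∀ c hc0, (F c hc0).sgn = -1 := fun c hc0 => by rw [CornerCut.sgn, hv]; rfl
    have hadm0 := hadm
    rw [hv] at hadm0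
    have hadm0 : ∀ᶠ x in cocompact ℂ, (F 1 one_pos).Admissible x := hadm0
    obtain ⟨K, hK, hKsub⟩ := mem_cocompact.1 hadm0
    obtain ⟨R, hR, hKR⟩ := hK.isBounded.subset_closedBall_lt 0 0
    -- The height is at most the norm, so points of height at least `R + 1` lie outside the
    -- exceptional ball of radius `R`.
    have hc0 : 0 < R + 1 := by linarith
    refine ⟨F (R + 1) hc0, hadm.mono (hadm' _ _), ?_, fun x hx => ?_⟩
    · rw [hv]
      change ∀ᶠ x in cocompact ℂ, _
      filter_upwards [tendsto_norm_cocompact_atTop.eventually_gt_atTop ((R + 1) / μ)] with x hx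
      have h1 := (F _ hc0).le_height x
      rw [hcen, sub_zero] at h1
      change μ * _ ≤ _ at h1
      rw [div_lt_iff₀ hμ] at hx
      rw [CornerCut.level, hsgn]
      change 0 < -(-1) * (_ - (R + 1))
      linarith
    · rw [CornerCut.level, hsgn] at hx
      change 0 ≤ -(-1) * (_ - (R + 1)) at hx
      have h1 := (F _ hc0).height_le x
      rw [hcen, sub_zero] at h1
      have h2 : R < ‖x‖ := by linarith
      filter_upwards [continuousAt_const.eventually_lt continuous_norm.continuousAt h2] with y hy
      refine hadm' _ _ _ (hKsub fun hyK => ?_)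
      have := hKR hyK
      rw [mem_closedBall_zero_iff] at this
      linarith

/-! ## The initial folding -/

theorem IsCone.isCreasePoint {m n : ℂ} {u : Fin 4 → ℂ} (h : IsCone m n u) (i : Fin 4) {t : ℝ}
    (ht : 0 < t) : IsCreasePoint (coneFold m n) (t • u i) := by
  obtain ⟨B, k, hk, hki, -, -, hB⟩ := (h.smul (r := fun _ => t) fun _ => ht).eventually_crease i
  refine isCreasePoint_of_eventually (b := B (t • u i)) (L := B) hk ?_
  filter_upwards [hB] with z hz
  have h1 : halfFold k (t • u i) = t • u i := halfFold_of_nonpos hki.le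
  rw [hz, ← map_add]
  congr 1
  conv_lhs => rw [← add_sub_cancel (t • u i) z, halfFold_add (by rw [hki, zero_mul]), h1]

theorem IsCone.isVertexPoint {m n : ℂ} {u : Fin 4 → ℂ} (h : IsCone m n u) :
    IsVertexPoint (coneFold m n) 0 :=
  isVertexPoint_of_eventually (b := 0) (L := LinearIsometryEquiv.refl ℝ ℂ) h.norm_m h.norm_n h.m1
    h.n1 (Eventually.of_forall fun x => by simp [coneFold])

theorem IsCone.cases_of_ne_zero {m n : ℂ} {u : Fin 4 → ℂ} (h : IsCone m n u) {x : ℂ} (hx : x ≠ 0) :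
    IsUnfoldedPoint (coneFold m n) x ∨ IsCreasePoint (coneFold m n) x := by
  by_cases hx' : inner ℝ m x = 0 ∨ inner ℝ n (halfFold m x) = 0
  · obtain ⟨i, t, ht, rfl⟩ := h.exists_ray hx hx'
    exact Or.inr (h.isCreasePoint i ht)
  · push Not at hx'
    obtain ⟨B, hB⟩ := coneFold_eventually h.norm_m h.norm_n hx'.1 hx'.2
    refine Or.inl (isUnfoldedPoint_of_eventually (b := B x) (L := B) ?_)
    filter_upwards [hB] with z hz
    rw [hz, ← map_add, add_sub_cancel]

theorem IsCone.isVertexPoint_iff {m n : ℂ} {u : Fin 4 → ℂ} (h : IsCone m n u) {x : ℂ} :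
    IsVertexPoint (coneFold m n) x ↔ x = 0 := by
  refine ⟨fun hx => ?_, ?_⟩
  · by_contra h0
    exact (h.cases_of_ne_zero h0).elim hx.1 hx.2.1
  · rintro rfl
    exact h.isVertexPoint

theorem isCone_axes : IsCone (-Complex.I) (-1) ![1, Complex.I, -1, -Complex.I] where
  norm_m := by simp
  norm_n := by simp
  m0 := by simp [Complex.inner]
  m1 := by simp
  m2 := by simp [Complex.inner]
  m3 := by simp
  n1 := by simp [Complex.inner]
  n3 := by
    rw [show (![1, Complex.I, -1, -Complex.I] : Fin 4 → ℂ) 3 = -Complex.I from rfl,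
      halfFold_of_nonneg (by simp) (by simp), mirror_self (by simp)]
    simp [Complex.inner]
  n02 := by simp

/-- For use at ∞, where the outward directions occur in clockwise order. -/
theorem isCone_axes_clockwise :
    IsCone (-1) (-Complex.I) ![Complex.I, 1, -Complex.I, -1] where
  norm_m := by simp
  norm_n := by simp
  m0 := by simp [Complex.inner]
  m1 := by simp
  m2 := by simp [Complex.inner]
  m3 := by simp
  n1 := by simp [Complex.inner]
  n3 := by
    rw [show (![Complex.I, 1, -Complex.I, -1] : Fin 4 → ℂ) 3 = -1 from rfl,
      halfFold_of_nonneg (by simp) (by simp), mirror_self (by simp)]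
    simp [Complex.inner]
  n02 := by simp

theorem halfFold_neg_one (z : ℂ) : halfFold (-1) z = ⟨|z.re|, z.im⟩ := by
  have h : (inner ℝ (-1) z : ℝ) = -z.re := by simp [Complex.inner]
  rw [halfFold, h]
  rcases le_total 0 z.re with h0 | h0
  · rw [max_eq_right (by linarith), abs_of_nonneg h0]
    simp
  · rw [max_eq_left (by linarith), abs_of_nonpos h0]
    apply Complex.ext <;> simp
    ring

theorem halfFold_neg_I (z : ℂ) : halfFold (-Complex.I) z = ⟨z.re, |z.im|⟩ := by
  have h : (inner ℝ (-Complex.I) z : ℝ) = -z.im := by simp [Complex.inner]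
  rw [halfFold, h]
  rcases le_total 0 z.im with h0 | h0
  · rw [max_eq_right (by linarith), abs_of_nonneg h0]
    simp
  · rw [max_eq_left (by linarith), abs_of_nonpos h0]
    apply Complex.ext <;> simp
    ring

/-- The plane, folded along both coordinate axes. -/
noncomputable def axesFold : ℂ → ℂ := coneFold (-Complex.I) (-1)

/-- Folds along perpendicular lines commute, so one map is described by both cones. -/
theorem axesFold_eq (z : ℂ) : axesFold z = coneFold (-1) (-Complex.I) z := by
  rw [axesFold, coneFold, coneFold, halfFold_neg_I, halfFold_neg_one, halfFold_neg_one,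
    halfFold_neg_I]

/-- The direction of the `j`-th edge of the dipole, from the origin to infinity. -/
noncomputable def axesDir : ZMod 4 → ℂ := fun j => (![1, -Complex.I, -1, Complex.I] : Fin 4 → ℂ) j

theorem isCreaseRay_axesDir (j : ZMod 4) : IsCreaseRay axesFold 0 (axesDir j) := by
  have h : ∀ j : Fin 4, ‖axesDir j‖ = 1 ∧
      ∃ i, axesDir j = (![1, Complex.I, -1, -Complex.I] : Fin 4 → ℂ) i := by
    refine Fin.forall_four ⟨?_, 0, rfl⟩ ⟨?_, 3, rfl⟩ ⟨?_, 2, rfl⟩ ⟨?_, 1, rfl⟩ <;> simp [axesDir]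
  obtain ⟨h1, i, h2⟩ := h j
  refine ⟨h1, fun t ht => ?_⟩
  rw [zero_add, h2, ← Complex.real_smul]
  exact isCone_axes.isCreasePoint i ht

/-- The vertices of the initial folding. -/
noncomputable def axesVertex : Bool → FoldVertex axesFold
  | false => .point 0 isCone_axes.isVertexPoint
  | true => .infinity ⟨_, _, isCreaseRay_axesDir 0⟩

theorem axesVertex_bijective : Function.Bijective axesVertex := by
  constructor
  · rintro (_ | _) (_ | _) h <;> simp_all [axesVertex]
  · rintro (⟨p, hp⟩ | _)
    · obtain rfl := isCone_axes.isVertexPoint_iff.1 hp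
      exact ⟨false, rfl⟩
    · exact ⟨true, rfl⟩

/-- The dipole is the graph of the initial folding. -/
noncomputable def axesModel : FoldModel dipole axesFold where
  cont := continuous_coneFold _ _
  cases_point p := by
    rcases eq_or_ne p 0 with rfl | hp
    · exact Or.inr (Or.inr isCone_axes.isVertexPoint)
    · exact (isCone_axes.cases_of_ne_zero hp).imp_right Or.inl
  exists_ray := ⟨_, _, isCreaseRay_axesDir 0⟩
  onV := Equiv.ofBijective axesVertex axesVertex_bijective
  dir d := if d.1 then -axesDir d.2 else axesDir d.2
  dir_rev := by
    rintro ⟨b, j⟩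
    cases b <;> simp [dipole]
  link := by
    rintro ⟨b, j⟩
    cases b
    · exact ⟨isCreaseRay_axesDir j, 0, le_rfl, (zero_smul ℝ _).symm⟩
    · refine ⟨?_, 0, le_rfl, (zero_smul ℝ _).symm⟩
      change IsCreaseRay axesFold 0 (- -axesDir j)
      rw [neg_neg]
      exact isCreaseRay_axesDir j
  cone := by
    rintro (_ | _)
    · refine ⟨![(false, 0), (false, 3), (false, 2), (false, 1)], -Complex.I, -1, 0,
        LinearIsometryEquiv.refl ℝ ℂ, Fin.forall_four rfl rfl rfl rfl,
        Fin.forall_four rfl rfl rfl rfl, ?_, ?_, Eventually.of_forall fun x => ?_⟩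
      · convert isCone_axes using 1
        funext i
        revert i
        refine Fin.forall_four ?_ ?_ ?_ ?_ <;> exact one_smul ℝ _
      · intro i
        change 0 < (1 : ℝ) * _
        revert i
        refine Fin.forall_four ?_ ?_ ?_ ?_ <;> simp [cross, axesDir]
      · change axesFold x = 0 + coneFold _ _ (x - 0)
        rw [zero_add, sub_zero]
        rfl
    -- The list starts with dart 3, whose edge leaves the origin in the direction `I`, to match the
    -- first vector of `isCone_axes_clockwise`.
    · refine ⟨![(true, 3), (true, 0), (true, 1), (true, 2)], -1, -Complex.I, 0,
        LinearIsometryEquiv.refl ℝ ℂ, Fin.forall_four rfl rfl rfl rfl,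
        Fin.forall_four rfl rfl rfl rfl, ?_, ?_, Eventually.of_forall fun x => ?_⟩
      · convert isCone_axes_clockwise using 1
        funext i
        revert i
        refine Fin.forall_four ?_ ?_ ?_ ?_ <;> exact (neg_one_smul ℝ _).trans (neg_neg _)
      · intro i
        change 0 < (-1 : ℝ) * _
        revert i
        refine Fin.forall_four ?_ ?_ ?_ ?_ <;> simp [cross, axesDir]
      · change axesFold x = 0 + coneFold _ _ (x - 0)
        rw [zero_add, sub_zero]
        exact axesFold_eq x

/-! ## Isomorphic graphs -/

namespace RotationSystem.Iso

variable {G H : RotationSystem} (e : G.Iso H)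
include e

theorem tail_symm (d : H.D) : G.tail (e.onD.symm d) = e.onV.symm (H.tail d) := by
  rw [Equiv.eq_symm_apply, ← e.tail_onD, Equiv.apply_symm_apply]

theorem rev_symm (d : H.D) : G.rev (e.onD.symm d) = e.onD.symm (H.rev d) := by
  rw [Equiv.eq_symm_apply, ← e.rev_onD, Equiv.apply_symm_apply]

end RotationSystem.Iso

/-- A folding with the graph `G` is a folding with any graph isomorphic to `G`. -/
def FoldModel.iso {G H : RotationSystem} {φ : ℂ → ℂ} (M : FoldModel G φ) (e : G.Iso H) :
    FoldModel H φ where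
  cont := M.cont
  cases_point := M.cases_point
  exists_ray := M.exists_ray
  onV := e.onV.symm.trans M.onV
  dir d := M.dir (e.onD.symm d)
  dir_rev d := by rw [← e.rev_symm, M.dir_rev]
  link d := by
    have := M.link (e.onD.symm d)
    rwa [e.rev_symm, e.tail_symm, e.tail_symm] at this
  cone y := by
    obtain ⟨w, m, n, b, L, h⟩ := M.cone (e.onV.symm y)
    refine ⟨fun i => e.onD (w i), m, n, b, L, fun i => ?_, fun i => ?_, ?_, fun i => ?_, h.germ⟩
    · rw [e.tail_onD, h.tail, Equiv.apply_symm_apply]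
    · rw [e.rot_onD, h.rot]
    · simpa using h.isCone
    · simpa using h.orient i

/-- The symmetry of the dipole that exchanges its vertices. -/
def dipoleSwap : dipole.Iso dipole where
  onV := Equiv.boolNot
  onD := Equiv.prodCongr Equiv.boolNot (Equiv.neg (ZMod 4))
  tail_onD _ := rfl
  rev_onD _ := rfl
  rot_onD := by
    rintro ⟨b, j⟩
    cases b
    · exact Prod.ext rfl (show -j + 1 = -(j - 1) by ring)
    · exact Prod.ext rfl (show -j - 1 = -(j + 1) by ring)

theorem exists_initial_model {G : RotationSystem} (e : dipole.Iso G) (w : G.V) :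
    ∃ M : FoldModel G axesFold, ∃ h, M.onV w = .infinity h := by
  rcases hw : e.onV.symm w with _ | _
  · refine ⟨(axesModel.iso dipoleSwap).iso e, axesModel.exists_ray, ?_⟩
    change axesVertex (!(e.onV.symm w)) = _
    rw [hw]
    rfl
  · refine ⟨axesModel.iso e, axesModel.exists_ray, ?_⟩
    change axesVertex (e.onV.symm w) = _
    rw [hw]
    rfl

/-! ## Global properties of the foldings -/

namespace FoldModel

variable {G : RotationSystem} {φ : ℂ → ℂ} (M : FoldModel G φ)
include M

theorem isLocalFlatFolding : IsLocalFlatFolding φ := by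
  refine ⟨M.cont, M.cases_point, ?_⟩
  obtain ⟨y, hy⟩ := M.onV.surjective (.infinity M.exists_ray)
  obtain ⟨w, m, n, b, L, h⟩ := M.cone y
  have hl := M.link (w 0)
  rw [h.tail, hy] at hl
  -- No edge joins ∞ to itself, so the other end of an edge at ∞ is a vertex point.
  rcases hr : M.onV (G.tail (G.rev (w 0))) with ⟨p, hp⟩ | _
  · exact ⟨p, hp⟩
  · rw [hr] at hl
    exact hl.elim

/-- Outside a compact set the image lies in the wedge around the axis of the cone at ∞. The rest of
the image is bounded and is absorbed by moving the apex backwards along the axis. -/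
theorem imageInWedge : ImageInWedge φ := by
  obtain ⟨y, hy⟩ := M.onV.surjective (.infinity M.exists_ray)
  obtain ⟨w, m, n, b, L, h⟩ := M.cone y
  obtain ⟨a, ha, μ, hμ, hle⟩ := h.isCone.exists_axis
  have hgerm := h.germ
  rw [hy] at hgerm
  have hgerm : ∀ᶠ x in cocompact ℂ, φ x = b + L (coneFold m n (x - 0)) := hgerm
  obtain ⟨K, hK, hKsub⟩ := mem_cocompact.1 hgerm
  obtain ⟨R, hR⟩ := hK.exists_bound_of_continuousOn (f := fun x => φ x - b)
    (M.cont.sub continuous_const).continuousOn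
  set e : ℂ := L a with he
  have hne : ‖e‖ = 1 := by rw [he, L.norm_map, ha]
  have hee : e * (starRingEnd ℂ) e = 1 := by
    rw [Complex.mul_conj, Complex.normSq_eq_norm_sq, hne]
    norm_num
  have he0 : e ≠ 0 := left_ne_zero_of_mul_eq_one hee
  -- On `K` the real part may be as low as `-|R|` while `μ` times the imaginary part may reach `μ *
  -- |R|`; this shift compensates for both.
  set T : ℝ := |R| * (1 + μ) with hT
  have hT0 : 0 ≤ T := by positivity
  have hnorm : ∀ z, ‖(starRingEnd ℂ) e * z‖ = ‖z‖ := by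
    intro z
    rw [norm_mul, Complex.norm_conj, hne, one_mul]
  have hwedge : ∀ x, μ * |((starRingEnd ℂ) e * (φ x - b)).im| ≤
      ((starRingEnd ℂ) e * (φ x - b)).re + T := by
    intro x
    have him := Complex.abs_im_le_norm ((starRingEnd ℂ) e * (φ x - b))
    rw [hnorm] at him
    by_cases hx : x ∈ K
    · have hre := (abs_le.1 (Complex.abs_re_le_norm ((starRingEnd ℂ) e * (φ x - b)))).1
      rw [hnorm] at hre
      have h1 : ‖φ x - b‖ ≤ |R| := (hR x hx).trans (le_abs_self R)
      have h2 : μ * |((starRingEnd ℂ) e * (φ x - b)).im| ≤ μ * |R| :=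
        mul_le_mul_of_nonneg_left (him.trans h1) hμ.le
      rw [hT]
      linarith
    · have hφ : φ x = b + L (coneFold m n (x - 0)) := hKsub hx
      rw [hφ, add_sub_cancel_left] at him ⊢
      have h1 := hle (x - 0)
      rw [L.norm_map, h.isCone.norm_coneFold] at him
      have h2 : ((starRingEnd ℂ) e * L (coneFold m n (x - 0))).re =
          inner ℝ a (coneFold m n (x - 0)) := by
        rw [← L.inner_map_map, Complex.inner, mul_comm]
      rw [h2]
      have := mul_le_mul_of_nonneg_left him hμ.le
      linarith
  refine ⟨b - T * e, e * (1 + (μ⁻¹ : ℝ) * Complex.I), e * (1 - (μ⁻¹ : ℝ) * Complex.I), ?_,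
    fun x => ?_⟩
  · rw [LinearIndependent.pair_iff]
    intro s t hst
    have h1 : (s * (1 + (μ⁻¹ : ℝ) * Complex.I) + t * (1 - (μ⁻¹ : ℝ) * Complex.I) : ℂ) = 0 := by
      refine (mul_eq_zero.1 (?_ : e * _ = 0)).resolve_left he0
      rw [← hst, Complex.real_smul, Complex.real_smul]
      ring
    have hre := congrArg Complex.re h1
    have him := congrArg Complex.im h1
    simp only [Complex.add_re, Complex.mul_re, Complex.ofReal_re, Complex.one_re, Complex.I_re,
      Complex.ofReal_im, Complex.I_im, Complex.add_im, Complex.mul_im, Complex.one_im,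
      Complex.sub_re, Complex.sub_im, Complex.zero_re, Complex.zero_im] at hre him
    have h2 : (s - t) * μ⁻¹ = 0 := by linarith
    have h3 : s - t = 0 := (mul_eq_zero.1 h2).resolve_right (inv_ne_zero hμ.ne')
    constructor <;> linarith
  · set ζ : ℂ := (starRingEnd ℂ) e * (φ x - b) with hζ
    have hx := hwedge x
    rw [← hζ] at hx
    have habs : |μ * ζ.im| ≤ ζ.re + T := by rwa [abs_mul, abs_of_pos hμ]
    obtain ⟨h1, h2⟩ := abs_le.1 habs
    -- In coordinates rotated by `e`, the sides have directions `1 ± i / μ`: the coefficients must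
    -- have sum `ζ.re + T` and difference `μ * ζ.im`.
    refine ⟨(ζ.re + T + μ * ζ.im) / 2, (ζ.re + T - μ * ζ.im) / 2, by linarith, by linarith, ?_⟩
    have h3 : φ x = b + e * ζ := by
      rw [hζ, ← mul_assoc, hee, one_mul]
      ring
    have h4 : (μ : ℂ) * (μ : ℂ)⁻¹ = 1 := mul_inv_cancel₀ (by exact_mod_cast hμ.ne')
    conv_lhs => rw [h3, ← Complex.re_add_im ζ]
    push_cast
    linear_combination (-e * ζ.im * Complex.I) * h4

/-- Wheel replacements are realized by folding over corners. -/
theorem exists_wheel {H : RotationSystem} (v : G.V) (e : (G.wheelReplace v).Iso H) :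
    ∃ (ψ : ℂ → ℂ) (_ : FoldModel H ψ), FoldsCornerOver φ (M.onV v) ψ := by
  obtain ⟨F, hF⟩ := M.exists_isSmall v
  exact ⟨F.folded, (CornerCut.wheelModel hF).iso e, CornerCut.foldsCornerOver hF⟩

end FoldModel

/-! ### Induction over wheel replacements -/

theorem IsDualOrthotree.exists_model {G : RotationSystem} (hG : IsDualOrthotree G) :
    ∃ φ : ℂ → ℂ, Nonempty (FoldModel G φ) := by
  induction hG with
  | start G h => exact ⟨_, ⟨axesModel.iso h.some⟩⟩
  | wheel G H v _ h ih =>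
    obtain ⟨φ, ⟨M⟩⟩ := ih
    obtain ⟨ψ, N, -⟩ := M.exists_wheel v h.some
    exact ⟨ψ, ⟨N⟩⟩

theorem mainTheorem6 :
    -- every dual orthotree is the graph of a local flat folding
    (∀ G : RotationSystem, IsDualOrthotree G →
      ∃ φ : ℂ → ℂ, IsLocalFlatFolding φ ∧ Nonempty (FoldRealization G φ)) ∧
    -- and each sequence of wheel replacements can be followed by folding over corners, starting
    -- with either vertex `w` of the initial multigraph in the role of `∞`
    (∀ (k : ℕ) (G : Fin (k + 1) → RotationSystem) (v : ∀ i : Fin k, (G i.castSucc).V),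
      Nonempty (dipole.Iso (G 0)) →
      (∀ i : Fin k, Nonempty (((G i.castSucc).wheelReplace (v i)).Iso (G i.succ))) →
      ∀ w : (G 0).V,
        ∃ (φ : Fin (k + 1) → ℂ → ℂ) (e : ∀ i, FoldRealization (G i) (φ i)),
          (∃ h, (e 0).onV w = FoldVertex.infinity h) ∧
          (∀ i, IsLocalFlatFolding (φ i) ∧ ImageInWedge (φ i)) ∧
          ∀ i : Fin k,
            FoldsCornerOver (φ i.castSucc) ((e i.castSucc).onV (v i)) (φ i.succ)) := by
  refine ⟨fun G hG => ?_, fun k G v h0 hstep w => ?_⟩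
  · obtain ⟨φ, ⟨M⟩⟩ := hG.exists_model
    exact ⟨φ, M.isLocalFlatFolding, ⟨M.realization⟩⟩
  · obtain ⟨M₀, hM₀⟩ := exists_initial_model h0.some w
    -- The recursion carries whole models, not just realizations, because the next fold needs the
    -- cones; the choice at each step is made as a function of the preceding model.
    choose f N hN using fun (i : Fin k) (s : (φ : ℂ → ℂ) × FoldModel (G i.castSucc) φ) =>
      s.2.exists_wheel (v i) (hstep i).some
    let S : ∀ i : Fin (k + 1), (φ : ℂ → ℂ) × FoldModel (G i) φ :=
      Fin.induction ⟨axesFold, M₀⟩ fun i s => ⟨f i s, N i s⟩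
    have hS : ∀ i : Fin k, S i.succ = ⟨f i (S i.castSucc), N i (S i.castSucc)⟩ :=
      fun i => Fin.induction_succ ..
    refine ⟨fun i => (S i).1, fun i => (S i).2.realization, hM₀,
      fun i => ⟨(S i).2.isLocalFlatFolding, (S i).2.imageInWedge⟩, fun i => ?_⟩
    change FoldsCornerOver (S i.castSucc).1 ((S i.castSucc).2.onV (v i)) (S i.succ).1
    rw [hS i]
    exact hN i (S i.castSucc)
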